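/- Let $A=\{0,\dots,m-1\}$ with $m\ge 2$, let $D\ge 0$, and let $\mathcal T(D)$ be the class of proper $m$-ary trees of depth at most $D$ (every internal node has all $m$ children). A tree $T\in\mathcal T(D)$ is identified with its set of leaves, which are strings over $A$ (contexts, read from the most recent symbol backwards). A variable-memory chain with model $T\in\mathcal T(D)$ and parameters $\theta=\{\theta_s;s\in T\}$, each $\theta_s$ a probability vector on $A$, is an $A$-valued process $(X_k)_{k\ge -D+1}$, with arbitrary initial context $X_{-D+1}^0$, such that $\mathbb P(X_{n+1}=a\mid X_{-D+1}^{n})=\theta_s(a)$ for all $n\ge 0$, $a\in A$, where $s$ is the unique leaf of $T$ that is a suffix of $X_{n-D+1}^{n}$. It is ergodic if the first-order chain $Z_n=X_{n-D+1}^n$ on $A^D$ is irreducible and aperiodic. The model $T$ is minimal with respect to $\theta$ if $T=\{\lambda\}$, where $\lambda$ is the empty string, or every $m$-tuple of sibling leaves $\{sj;\,j\in A\}$ of $T$ contains two with different parameters. For $\beta\in(0,1)$ put on $\mathcal T(D)$ the prior $\pi_D(T)=\alpha^{|T|-1}\beta^{|T|-L_D(T)}$, where $\alpha=(1-\beta)^{1/(m-1)}$,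 $|T|$ is the number of leaves of $T$ and $L_D(T)$ is the number of its leaves at depth $D$. Given $T$, let the $\theta_s$, $s\in T$, be independent with the Dirichlet$(1/2,\dots,1/2)$ distribution $\pi(\theta_s)$. For a sample $x=x_{-D+1}^n$ let $P(x\mid T)=\int\prod_{s\in T}\prod_{j\in A}\theta_s(j)^{a_s(j)}\,\prod_{s\in T}\pi(d\theta_s)$, where $a_s(j)$ is the number of times $j$ follows context $s$ in $x_1^n$, and let $\pi(T\mid x)=\pi_D(T)P(x\mid T)\big/\sum_{T'\in\mathcal T(D)}\pi_D(T')P(x\mid T')$. A MAP model is any maximiser of $\pi(\cdot\mid x)$ over $\mathcal T(D)$. Theorem. Let $\{X_n\}$ be an ergodic variable-memory chain with model $T^*\in\mathcal T(D)$ and parameters $\theta^*$, where $T^*$ is minimal with respect to $\theta^*$. Then for every $\beta\in(0,1)$, almost surely, for all sufficiently large $n$ the MAP model $T^*(n)$ based on the sample $X_{-D+1}^n$ is unique and $T^*(n)=T^*$. -/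

import Mathlib

open MeasureTheory ProbabilityTheory Filter

namespace BCT

/-- Proper `m`-ary trees: every node is either a leaf or has all of its `m` children. -/
inductive Tree (m : ℕ) : Type
  | leaf : Tree m
  | node (child : Fin m → Tree m) : Tree m

namespace Tree

variable {m : ℕ}

/-- Depth of a tree; the one-node tree `{λ}` has depth `0`. -/
def depth : Tree m → ℕ
  | leaf => 0
  | node c => (Finset.univ.sup fun j => (c j).depth) + 1

/-- The leaves of a tree, as contexts (strings). The first letter of a context is the most recent
symbol; the children of the node `s` are the strings `s ++ [j]`. -/
def leaves : Tree m → Finset (List (Fin m))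
  | leaf => {[]}
  | node c => Finset.univ.biUnion fun j => (c j).leaves.image (List.cons j)

end Tree

/-- `Model m D`: the class of all proper `m`-ary trees of depth at most `D`. -/
def Model (m D : ℕ) : Type := {T : Tree m // T.depth ≤ D}

/-- There are only finitely many models of depth at most `D`. -/
theorem finite_setOf_depth_le (m D : ℕ) : {T : Tree m | T.depth ≤ D}.Finite := by
  induction D with
  | zero =>
    refine (Set.finite_singleton (Tree.leaf : Tree m)).subset ?_
    rintro (_ | c) h
    · rfl
    · simp [Tree.depth] at h
  | succ D ih =>
    refine ((Set.finite_singleton (Tree.leaf : Tree m)).union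
      ((Set.Finite.pi' fun _ : Fin m => ih).image Tree.node)).subset ?_
    rintro (_ | c) h
    · exact Or.inl rfl
    · refine Or.inr ⟨c, fun j => ?_, rfl⟩
      have h' : (Finset.univ.sup fun j => (c j).depth) ≤ D := by
        simpa [Tree.depth] using h
      exact le_trans (Finset.le_sup (f := fun j => (c j).depth) (Finset.mem_univ j)) h'

noncomputable instance (m D : ℕ) : Fintype (Model m D) :=
  (finite_setOf_depth_le m D).fintype

namespace Model

variable {m D : ℕ}

/-- The leaves (contexts) of a model. -/
def leaves (T : Model m D) : Finset (List (Fin m)) := T.1.leaves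

/-- A family `θ = {θ_s ; s ∈ T}` of real vectors indexed by the leaves of `T`. -/
abbrev Params (T : Model m D) : Type := T.leaves → Fin m → ℝ

/-- `θ` is a parameter vector: each `θ_s` is a probability vector. -/
def IsParam (T : Model m D) (θ : T.Params) : Prop := ∀ s, θ s ∈ stdSimplex ℝ (Fin m)

/-- `T` is minimal with respect to `θ`: any `m`-tuple of sibling leaves carries at least two
different parameters (vacuous for the tree `{λ}`). -/
def IsMinimal (T : Model m D) (θ : T.Params) : Prop :=
  ∀ (s : List (Fin m)) (h : ∀ j, s ++ [j] ∈ T.leaves),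
    ∃ j j', θ ⟨s ++ [j], h j⟩ ≠ θ ⟨s ++ [j'], h j'⟩

end Model

/-- `s` is the context of the block `z` of the last `D` symbols (`z` in chronological order, `s`
with the most recent symbol first). -/
def IsContext {m D : ℕ} (s : List (Fin m)) (z : Fin D → Fin m) : Prop :=
  s <+: (List.ofFn z).reverse

instance {m D : ℕ} (s : List (Fin m)) (z : Fin D → Fin m) : Decidable (IsContext s z) :=
  inferInstanceAs (Decidable (_ <+: _))

/-- The probability `θ_s(a)` that the next symbol is `a` given that the last `D` symbols are `z`,
where `s` is the leaf of `T` which is the context of `z` (exactly one leaf is, so exactly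
one summand counts). -/
noncomputable def stepProb {m D : ℕ} (T : Model m D) (θ : T.Params) (z : Fin D → Fin m)
    (a : Fin m) : ℝ :=
  ∑ s : T.leaves, if IsContext s.1 z then θ s a else 0

/-- The last `D` symbols after `a` has been appended to `z`. -/
def shift {m D : ℕ} (z : Fin D → Fin m) (a : Fin m) : Fin D → Fin m :=
  Fin.tail (Fin.snoc z a : Fin (D + 1) → Fin m)

/-- Transition matrix of the first order chain `Z_n = X_{n-D+1}^n` on `A^D`. -/
noncomputable def transMatrix {m D : ℕ} (T : Model m D) (θ : T.Params) :
    Matrix (Fin D → Fin m) (Fin D → Fin m) ℝ :=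
  Matrix.of fun z z' => ∑ a, if shift z a = z' then stepProb T θ z a else 0

/-- A transition matrix is aperiodic if for each state the possible return times have greatest
common divisor one. -/
def IsAperiodic {ι : Type*} [Fintype ι] [DecidableEq ι] (P : Matrix ι ι ℝ) : Prop :=
  ∀ z, ∀ d : ℕ, (∀ k, 0 < k → 0 < (P ^ k) z z → d ∣ k) → d = 1

/-- The chain with model `T` and parameters `θ` is ergodic: the first order chain on `A^D` is
irreducible and aperiodic. -/
def IsErgodic {m D : ℕ} (T : Model m D) (θ : T.Params) : Prop :=
  (transMatrix T θ).IsIrreducible ∧ IsAperiodic (transMatrix T θ)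

/-- The block `x i, …, x (i + D - 1)`. -/
def window {m : ℕ} (D : ℕ) (x : ℕ → Fin m) (i : ℕ) : Fin D → Fin m := fun k => x (i + k)

/-- `X` is a variable-memory chain with model `T` and parameters `θ`. Time is shifted by `D - 1`:
`X k` is the symbol that is usually written `X_{k-D+1}`, so that `X 0, …, X (D - 1)` is the initial
context `X_{-D+1}^0`, whose law is arbitrary, and `X D, X (D + 1), …` are `X_1, X_2, …`.
The last clause says `ℙ(X_{n+1} = a | X_{-D+1}^n) = θ_s(a)`, multiplied out. -/
structure IsChain {m D : ℕ} {Ω : Type*} [MeasurableSpace Ω] (μ : Measure Ω)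
    (X : ℕ → Ω → Fin m) (T : Model m D) (θ : T.Params) : Prop where
  measurable : ∀ k, Measurable (X k)
  step : ∀ (n : ℕ) (x : ℕ → Fin m),
    μ.real {ω | ∀ k < D + n + 1, X k ω = x k} =
      μ.real {ω | ∀ k < D + n, X k ω = x k} * stepProb T θ (window D x n) (x (D + n))

/-- `a_s(j)`: how many times `j` follows the context `s` in `x_1^n`; the sample `x_{-D+1}^n` is
`x 0, …, x (D + n - 1)`. -/
def count {m : ℕ} (D : ℕ) (x : ℕ → Fin m) (n : ℕ) (s : List (Fin m)) (j : Fin m) : ℕ :=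
  ((Finset.range n).filter fun i => IsContext s (window D x i) ∧ x (D + i) = j).card

/-- The likelihood `P(x_1^n | x_{-D+1}^0, θ, T)`. -/
noncomputable def likelihood {m D : ℕ} (x : ℕ → Fin m) (n : ℕ) (T : Model m D)
    (θ : T.Params) : ℝ :=
  ∏ s : T.leaves, ∏ j, θ s j ^ count D x n s.1 j

/-- Prior `π_D(T; β) = α^{|T|-1} β^{|T|-L_D(T)}` on models, with `α = (1-β)^{1/(m-1)}` and `L_D(T)`
the number of leaves at depth `D`. -/
noncomputable def modelPrior {m D : ℕ} (β : ℝ) (T : Model m D) : ℝ :=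
  ((1 - β) ^ (1 / ((m : ℝ) - 1))) ^ (T.leaves.card - 1) *
    β ^ (T.leaves.card - (T.leaves.filter fun s => s.length = D).card)

/-- The probability vector with first `m - 1` coordinates `φ`. -/
noncomputable def ofFree {m : ℕ} (φ : Fin (m - 1) → ℝ) (j : Fin m) : ℝ :=
  if h : (j : ℕ) < m - 1 then φ ⟨j, h⟩ else 1 - ∑ i, φ i

/-- The Dirichlet distribution with parameters `(1/2, …, 1/2)` on probability vectors: in terms of
the first `m - 1` coordinates, which range over `{φ ≥ 0, ∑ φ ≤ 1}`, it has Lebesgue density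
`Γ(m/2) π^{-m/2} ∏_j θ(j)^{-1/2}`. -/
noncomputable def dirichletHalf (m : ℕ) : Measure (Fin m → ℝ) :=
  (((volume : Measure (Fin (m - 1) → ℝ)).restrict
      {φ | (∀ i, 0 ≤ φ i) ∧ ∑ i, φ i ≤ 1}).withDensity fun φ =>
    ENNReal.ofReal (Real.Gamma ((m : ℝ) / 2) / Real.pi ^ ((m : ℝ) / 2) *
      ∏ j : Fin m, ofFree φ j ^ (-(1 / 2) : ℝ))).map ofFree

/-- Prior on the parameters given the model: independent Dirichlet distributions. -/
noncomputable def paramPrior {m D : ℕ} (T : Model m D) : Measure T.Params :=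
  Measure.pi fun _ => dirichletHalf m

/-- The marginal likelihood `P(x | T) = ∫ P(x | θ, T) π(θ | T) dθ`. -/
noncomputable def marginal {m D : ℕ} (x : ℕ → Fin m) (n : ℕ) (T : Model m D) : ℝ :=
  ∫ θ, likelihood x n T θ ∂(paramPrior T)

/-- The posterior probability `π(T | x)` of a model, with `x = x_{-D+1}^n`. -/
noncomputable def posterior {m D : ℕ} (β : ℝ) (x : ℕ → Fin m) (n : ℕ) (T : Model m D) : ℝ :=
  modelPrior β T * marginal x n T / ∑ T' : Model m D, modelPrior β T' * marginal x n T'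

/-- `T` is a MAP model for the sample `x_{-D+1}^n`. -/
def IsMAP {m D : ℕ} (β : ℝ) (x : ℕ → Fin m) (n : ℕ) (T : Model m D) : Prop :=
  ∀ T' : Model m D, posterior β x n T' ≤ posterior β x n T

end BCT

/-!
The marginal likelihood of a model factors over its leaves `s` into Krichevsky–Trofimov
probabilities of the counts at `s` (`marginal_eq_prod_ktProb`, by the Dirichlet integral
`lintegral_dirichletKernel`). By Stirling's formula the logarithm of such a probability is the
maximal log-likelihood at `s` minus `(m - 1) / 2 * log n_s`, with `n_s` the number of visits to
`s`, up to a bounded error uniform in the counts (`exists_abs_log_ktProb_sub_le`). As there are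
finitely many models and the prior is positive, it suffices that for each model `S` other than the
true model `T` the difference `log P(x | T) - log P(x | S)` tends to infinity almost surely.

The randomness enters only through the notion of a typical sequence (`Typical`): transitions of
probability zero do not occur, and the deviation `M_n` of each transition count from its
compensator satisfies `M_n² = o(n log n)`. Almost every path is typical (`IsChain.ae_typical`). The
deviation bound comes from a mixture of the exponential supermartingales `exp (t M_n - t² n)` over
`t = 2⁻ᵏ` with weights `(k + 1)⁻²`: it is a nonnegative supermartingale, hence almost surely
bounded, and taking `2⁻ᵏ` close to `1 / √n` gives `|M_n| = O(√n log log n)`. For a typical sequence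
irreducibility forces each block of `D` symbols to have positive lower frequency
(`Typical.exists_visits_ge`): visits propagate along transitions of positive probability, and some
block must be visited often.

There are two kinds of wrong models.

* If `S` is a strict refinement of `T`, then its parameters can be chosen so as to reproduce the
  true chain. The gain of the maximal over the true log-likelihood is at most a `χ²` statistic
  (`logMaxLik_le_add_chiSq`), which is `o(log n)`, whereas `S` has more leaves than `T` and pays at
  least `1/2 * log n` more (`Typical.eventually_log_marginal_lt_of_refines`).
* Otherwise some leaf of `S` is an internal node of `T`, below which `T` has a full set of sibling
  leaves. By minimality two of these have different parameters, and merging their contexts costs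
  a multiple of `n` by a quadratic lower bound for the relative entropy
  (`logMaxLik_sum_add_le`), while all other terms are `O(log n)`
  (`Typical.eventually_log_marginal_lt_of_not_refines`).
-/

namespace BCT

/-! ### Contexts and trees -/

namespace Tree

variable {m : ℕ}

theorem mem_leaves_node {c : Fin m → Tree m} {s : List (Fin m)} :
    s ∈ (node c).leaves ↔ ∃ j, ∃ t ∈ (c j).leaves, j :: t = s := by
  simp [leaves]

theorem depth_child_lt (c : Fin m → Tree m) (j : Fin m) : (c j).depth < (node c).depth := by
  rw [depth, Nat.lt_succ_iff]
  exact Finset.le_sup (f := fun j => (c j).depth) (Finset.mem_univ j)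

theorem length_le_depth (T : Tree m) : ∀ s ∈ T.leaves, s.length ≤ T.depth := by
  induction T with
  | leaf => intro s hs; simp [leaves] at hs; simp [hs]
  | node c ih =>
    intro s hs
    obtain ⟨j, t, ht, rfl⟩ := mem_leaves_node.1 hs
    have := ih j t ht
    have := depth_child_lt c j
    simp only [List.length_cons]
    omega

theorem leaves_nonempty (hm : 0 < m) (T : Tree m) : T.leaves.Nonempty := by
  induction T with
  | leaf => simp [leaves]
  | node c ih =>
    obtain ⟨t, ht⟩ := ih ⟨0, hm⟩
    exact ⟨_, mem_leaves_node.2 ⟨_, t, ht, rfl⟩⟩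

theorem exists_leaf_prefix (T : Tree m) :
    ∀ l : List (Fin m), T.depth ≤ l.length → ∃ s ∈ T.leaves, s <+: l := by
  induction T with
  | leaf => intro l _; exact ⟨[], by simp [leaves], List.nil_prefix⟩
  | node c ih =>
    rintro (_ | ⟨j, l⟩) hl
    · simp [depth] at hl
    · have h1 := depth_child_lt c j
      simp only [List.length_cons] at hl
      obtain ⟨t, ht, htl⟩ := ih j l (by omega)
      exact ⟨j :: t, mem_leaves_node.2 ⟨j, t, ht, rfl⟩, List.cons_prefix_cons.2 ⟨rfl, htl⟩⟩

theorem leaf_prefix_unique (T : Tree m) : ∀ l s t : List (Fin m), s ∈ T.leaves → t ∈ T.leaves →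
    s <+: l → t <+: l → s = t := by
  induction T with
  | leaf => intro l s t hs ht _ _; simp [leaves] at hs ht; simp [hs, ht]
  | node c ih =>
    intro l s t hs ht hsl htl
    obtain ⟨j, s, hs', rfl⟩ := mem_leaves_node.1 hs
    obtain ⟨k, t, ht', rfl⟩ := mem_leaves_node.1 ht
    obtain _ | ⟨i, l⟩ := l
    · simp at hsl
    · rw [List.cons_prefix_cons] at hsl htl
      obtain ⟨rfl, hsl⟩ := hsl
      obtain ⟨rfl, htl⟩ := htl
      rw [ih _ l s t hs' ht' hsl htl]

theorem card_leaves_node (c : Fin m → Tree m) :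
    (node c).leaves.card = ∑ j, (c j).leaves.card := by
  rw [leaves, Finset.card_biUnion]
  · exact Finset.sum_congr rfl fun j _ =>
      Finset.card_image_of_injective _ (List.cons_injective)
  · intro i _ j _ hij
    rw [Function.onFun, Finset.disjoint_left]
    intro s hs ht
    simp only [Finset.mem_image] at hs ht
    obtain ⟨s', _, rfl⟩ := hs
    obtain ⟨t', _, h⟩ := ht
    exact hij (List.cons.inj h).1.symm

/-- `T` refines `S` if every leaf of `T` lies below (or at) a leaf of `S`, i.e. `S` is obtained
from `T` by pruning. -/
def Refines (T S : Tree m) : Prop := ∀ s ∈ T.leaves, ∃ t ∈ S.leaves, t <+: s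

theorem Refines.eq_or_card_lt (hm : 2 ≤ m) (S : Tree m) : ∀ T : Tree m, T.Refines S →
    T = S ∨ S.leaves.card < T.leaves.card := by
  induction S with
  | leaf =>
    rintro (_ | c) _
    · exact Or.inl rfl
    · right
      rw [card_leaves_node]
      calc 1 < m := hm
        _ = ∑ _j : Fin m, 1 := by simp
        _ ≤ _ := Finset.sum_le_sum fun j _ =>
          Finset.card_pos.2 (leaves_nonempty (by omega) (c j))
  | node b ih =>
    rintro (_ | c) h
    · obtain ⟨t, ht, htn⟩ := h [] (by simp [leaves])
      obtain ⟨j, t, _, rfl⟩ := mem_leaves_node.1 ht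
      simp at htn
    · have h' : ∀ j, (c j).Refines (b j) := by
        intro j s hs
        obtain ⟨t, ht, hts⟩ := h (j :: s) (mem_leaves_node.2 ⟨j, s, hs, rfl⟩)
        obtain ⟨i, t', ht', rfl⟩ := mem_leaves_node.1 ht
        rw [List.cons_prefix_cons] at hts
        obtain ⟨rfl, hts⟩ := hts
        exact ⟨t', ht', hts⟩
      have h2 := fun j => ih j (c j) (h' j)
      by_cases hall : ∀ j, c j = b j
      · exact Or.inl (congrArg node (funext hall))
      · right
        push Not at hall
        obtain ⟨j, hj⟩ := hall
        rw [card_leaves_node, card_leaves_node]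
        refine Finset.sum_lt_sum (fun i _ => ?_) ⟨j, Finset.mem_univ j, (h2 j).resolve_left hj⟩
        rcases h2 i with h3 | h3
        · rw [h3]
        · exact h3.le

/-- Below an internal node there is a complete family of sibling leaves. -/
theorem exists_sibling_leaves (S : Tree m) : ∀ c, S = node c →
    ∃ u, ∀ j, u ++ [j] ∈ S.leaves := by
  induction S with
  | leaf => intro c h; exact absurd h (by simp)
  | node b ih =>
    intro _ _
    by_cases h : ∀ j, b j = leaf
    · exact ⟨[], fun j => mem_leaves_node.2 ⟨j, [], by simp [h j, leaves], rfl⟩⟩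
    · push Not at h
      obtain ⟨j, hj⟩ := h
      obtain ⟨c, hc⟩ : ∃ c, b j = node c := by
        cases hb : b j with
        | leaf => exact absurd hb hj
        | node c => exact ⟨c, rfl⟩
      obtain ⟨u, hu⟩ := ih j c hc
      exact ⟨j :: u, fun k => mem_leaves_node.2 ⟨j, _, hu k, rfl⟩⟩

/-- A string which is not below any leaf of `S` is an internal node of `S`, so it has a complete
family of sibling leaves below it. -/
theorem exists_sibling_leaves_below (S : Tree m) : ∀ s : List (Fin m),
    (¬ ∃ t ∈ S.leaves, t <+: s) → ∃ u, ∀ j, s ++ u ++ [j] ∈ S.leaves := by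
  induction S with
  | leaf => intro s hs; exact absurd ⟨[], by simp [leaves], List.nil_prefix⟩ hs
  | node b ih =>
    rintro (_ | ⟨i, s⟩) hs
    · simpa using exists_sibling_leaves (node b) b rfl
    · obtain ⟨u, hu⟩ := ih i s (by
        rintro ⟨t, ht, hts⟩
        exact hs ⟨i :: t, mem_leaves_node.2 ⟨i, t, ht, rfl⟩, List.cons_prefix_cons.2 ⟨rfl, hts⟩⟩)
      exact ⟨u, fun j => mem_leaves_node.2 ⟨i, _, hu j, rfl⟩⟩

end Tree

section Context

variable {m D : ℕ}

theorem Model.length_le (T : Model m D) {s : List (Fin m)} (hs : s ∈ T.leaves) : s.length ≤ D :=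
  (T.1.length_le_depth s hs).trans T.2

theorem Model.exists_context (T : Model m D) (z : Fin D → Fin m) :
    ∃ s ∈ T.leaves, IsContext s z :=
  T.1.exists_leaf_prefix _ (by simpa using T.2)

theorem Model.context_unique (T : Model m D) {z : Fin D → Fin m} {s t : List (Fin m)}
    (hs : s ∈ T.leaves) (ht : t ∈ T.leaves) (hsz : IsContext s z) (htz : IsContext t z) : s = t :=
  T.1.leaf_prefix_unique _ s t hs ht hsz htz

/-- The leaf of `T` which is the context of the block `z`. -/
noncomputable def Model.ctx (T : Model m D) (z : Fin D → Fin m) : T.leaves :=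
  ⟨(T.exists_context z).choose, (T.exists_context z).choose_spec.1⟩

theorem Model.isContext_ctx (T : Model m D) (z : Fin D → Fin m) : IsContext (T.ctx z).1 z :=
  (T.exists_context z).choose_spec.2

theorem Model.isContext_iff (T : Model m D) (z : Fin D → Fin m) (s : T.leaves) :
    IsContext s.1 z ↔ T.ctx z = s :=
  ⟨fun h => Subtype.ext (T.context_unique (T.ctx z).2 s.2 (T.isContext_ctx z) h),
    fun h => h ▸ T.isContext_ctx z⟩

theorem stepProb_eq (T : Model m D) (θ : T.Params) (z : Fin D → Fin m) (a : Fin m) :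
    stepProb T θ z a = θ (T.ctx z) a := by
  simp [stepProb, T.isContext_iff]

theorem exists_isContext (hm : 0 < m) {s : List (Fin m)} (hs : s.length ≤ D) :
    ∃ z : Fin D → Fin m, IsContext s z := by
  set l : List (Fin m) := (s ++ List.replicate (D - s.length) (⟨0, hm⟩ : Fin m)).reverse with hl
  have hlen : l.length = D := by simp [hl]; omega
  refine ⟨fun i => l.get (i.cast hlen.symm), ?_⟩
  have : List.ofFn (fun i : Fin D => l.get (i.cast hlen.symm)) = l := by
    apply List.ext_getElem
    · simp [hlen]
    · intro i h1 h2; simp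
  rw [IsContext, this, hl, List.reverse_reverse]
  exact List.prefix_append _ _

theorem stepProb_nonneg {T : Model m D} {θ : T.Params} (hθ : T.IsParam θ) (z : Fin D → Fin m)
    (a : Fin m) : 0 ≤ stepProb T θ z a := by
  rw [stepProb_eq]; exact (hθ _).1 a

theorem sum_stepProb {T : Model m D} {θ : T.Params} (hθ : T.IsParam θ) (z : Fin D → Fin m) :
    ∑ a, stepProb T θ z a = 1 := by
  simp_rw [stepProb_eq]; exact (hθ _).2

theorem stepProb_le_one {T : Model m D} {θ : T.Params} (hθ : T.IsParam θ) (z : Fin D → Fin m)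
    (a : Fin m) : stepProb T θ z a ≤ 1 :=
  (sum_stepProb hθ z) ▸ Finset.single_le_sum (f := fun a => stepProb T θ z a)
    (fun b _ => stepProb_nonneg hθ z b) (Finset.mem_univ a)

/-- The number of times the block `z` is followed by the symbol `j` in the sample. -/
def blockCount {m : ℕ} (D : ℕ) (x : ℕ → Fin m) (n : ℕ) (z : Fin D → Fin m) (j : Fin m) : ℕ :=
  ((Finset.range n).filter fun i => window D x i = z ∧ x (D + i) = j).card

theorem count_eq_sum_blockCount (x : ℕ → Fin m) (n : ℕ) (s : List (Fin m)) (j : Fin m) :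
    count D x n s j = ∑ z with IsContext s z, blockCount D x n z j := by
  rw [count, Finset.card_eq_sum_card_fiberwise (f := fun i => window D x i)
    (t := Finset.univ.filter fun z => IsContext s z)]
  · refine Finset.sum_congr rfl fun z hz => ?_
    rw [blockCount, Finset.filter_filter]
    congr 1
    refine Finset.filter_congr fun i _ => ?_
    have hz' := (Finset.mem_filter.1 hz).2
    constructor
    · rintro ⟨⟨_, h2⟩, h3⟩; exact ⟨h3, h2⟩
    · rintro ⟨h1, h2⟩; exact ⟨⟨h1 ▸ hz', h2⟩, h1⟩
  · intro i hi
    exact Finset.mem_coe.2 (Finset.mem_filter.2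
      ⟨Finset.mem_univ _, (Finset.mem_filter.1 (Finset.mem_coe.1 hi)).2.1⟩)

end Context

/-! ### The Dirichlet integral -/

/-- The power function `t ^ a` on the positive reals, extended by zero. -/
noncomputable def posRpow (a t : ℝ) : ℝ := if 0 < t then t ^ a else 0

theorem posRpow_nonneg (a t : ℝ) : 0 ≤ posRpow a t := by
  unfold posRpow; split_ifs with h <;> positivity

theorem posRpow_of_nonpos (a : ℝ) {t : ℝ} (h : t ≤ 0) : posRpow a t = 0 := if_neg h.not_gt

theorem posRpow_of_pos (a : ℝ) {t : ℝ} (h : 0 < t) : posRpow a t = t ^ a := if_pos h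

theorem measurable_posRpow (a : ℝ) : Measurable (posRpow a) :=
  Measurable.ite measurableSet_Ioi (by fun_prop) measurable_const

theorem measurable_posRpow_mul_exp (a : ℝ) :
    Measurable fun t => posRpow a t * Real.exp (-t) :=
  (measurable_posRpow a).mul (by fun_prop)

theorem posRpow_mul (a : ℝ) {r : ℝ} (hr : 0 < r) (t : ℝ) :
    posRpow a (r * t) = r ^ a * posRpow a t := by
  rcases le_or_gt t 0 with h | h
  · rw [posRpow_of_nonpos _ h, posRpow_of_nonpos _ (mul_nonpos_of_nonneg_of_nonpos hr.le h),
      mul_zero]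
  · rw [posRpow_of_pos _ h, posRpow_of_pos _ (mul_pos hr h), Real.mul_rpow hr.le h.le]

theorem posRpow_mul_exp_eq_indicator (a : ℝ) : (fun t => posRpow (a - 1) t * Real.exp (-t)) =
    (Set.Ioi 0).indicator fun t => Real.exp (-t) * t ^ (a - 1) := by
  ext t
  by_cases h : 0 < t
  · rw [posRpow_of_pos _ h, Set.indicator_of_mem (Set.mem_Ioi.2 h), mul_comm]
  · rw [posRpow_of_nonpos _ (not_lt.1 h), Set.indicator_of_notMem (by simpa using h), zero_mul]

theorem integrable_posRpow_mul_exp {a : ℝ} (ha : 0 < a) :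
    Integrable fun t => posRpow (a - 1) t * Real.exp (-t) := by
  rw [posRpow_mul_exp_eq_indicator, integrable_indicator_iff measurableSet_Ioi]
  exact Real.GammaIntegral_convergent ha

theorem integral_posRpow_mul_exp {a : ℝ} (ha : 0 < a) :
    ∫ t, posRpow (a - 1) t * Real.exp (-t) = Real.Gamma a := by
  rw [posRpow_mul_exp_eq_indicator, integral_indicator measurableSet_Ioi, Real.Gamma_eq_integral ha]

theorem lintegral_posRpow_mul_exp {a : ℝ} (ha : 0 < a) :
    ∫⁻ t, ENNReal.ofReal (posRpow (a - 1) t * Real.exp (-t)) = ENNReal.ofReal (Real.Gamma a) := by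
  rw [← integral_posRpow_mul_exp ha, ofReal_integral_eq_lintegral_ofReal
    (integrable_posRpow_mul_exp ha)
    (Eventually.of_forall fun t => mul_nonneg (posRpow_nonneg _ _) (Real.exp_pos _).le)]

theorem lintegral_comp_smul_pi {d : ℕ} {r : ℝ} (hr : 0 < r) {f : (Fin d → ℝ) → ENNReal}
    (hf : Measurable f) :
    ∫⁻ x, f x = ENNReal.ofReal (r ^ d) * ∫⁻ x, f (r • x) := by
  have h := Measure.map_addHaar_smul (volume : Measure (Fin d → ℝ)) hr.ne'
  have h2 : ∫⁻ x, f (r • x) = ∫⁻ x, f x ∂(Measure.map (r • ·) (volume : Measure (Fin d → ℝ))) :=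
    (lintegral_map hf (measurable_const_smul r)).symm
  rw [h2, h, lintegral_smul_measure, smul_eq_mul, ← mul_assoc, ← ENNReal.ofReal_mul (by positivity)]
  simp only [Module.finrank_fintype_fun_eq_card, Fintype.card_fin]
  rw [abs_of_pos (by positivity), mul_inv_cancel₀ (by positivity), ENNReal.ofReal_one, one_mul]

/-- The integrand of the Dirichlet integral over the simplex of total mass `t`. -/
noncomputable def dirichletKernel {d : ℕ} (α : Fin d → ℝ) (b t : ℝ) (φ : Fin d → ℝ) : ℝ :=
  (∏ i, posRpow (α i - 1) (φ i)) * posRpow (b - 1) (t - ∑ i, φ i)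

theorem dirichletKernel_nonneg {d : ℕ} (α : Fin d → ℝ) (b t : ℝ) (φ : Fin d → ℝ) :
    0 ≤ dirichletKernel α b t φ :=
  mul_nonneg (Finset.prod_nonneg fun _ _ => posRpow_nonneg _ _) (posRpow_nonneg _ _)

theorem measurable_dirichletKernel {d : ℕ} (α : Fin d → ℝ) (b : ℝ) :
    Measurable fun p : ℝ × (Fin d → ℝ) => dirichletKernel α b p.1 p.2 := by
  unfold dirichletKernel
  refine Measurable.mul ?_ ?_
  · exact Finset.measurable_prod _ fun i _ => (measurable_posRpow _).comp (by fun_prop)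
  · exact (measurable_posRpow _).comp (by fun_prop)

theorem dirichletKernel_of_nonpos {d : ℕ} (α : Fin d → ℝ) (b : ℝ) {t : ℝ} (ht : t ≤ 0)
    (φ : Fin d → ℝ) : dirichletKernel α b t φ = 0 := by
  unfold dirichletKernel
  by_cases h : ∀ i, 0 < φ i
  · rw [posRpow_of_nonpos (b - 1), mul_zero]
    have := Finset.sum_nonneg fun i (_ : i ∈ Finset.univ) => (h i).le
    linarith
  · push Not at h
    obtain ⟨i, hi⟩ := h
    rw [Finset.prod_eq_zero (Finset.mem_univ i) (posRpow_of_nonpos _ hi), zero_mul]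

theorem dirichletKernel_smul {d : ℕ} (α : Fin d → ℝ) (b : ℝ) {t : ℝ} (ht : 0 < t)
    (φ : Fin d → ℝ) : dirichletKernel α b t (t • φ) =
      t ^ (∑ i, (α i - 1) + (b - 1)) * dirichletKernel α b 1 φ := by
  unfold dirichletKernel
  have h1 : t - ∑ i, (t • φ) i = t * (1 - ∑ i, φ i) := by
    simp only [Pi.smul_apply, smul_eq_mul, ← Finset.mul_sum]; ring
  rw [h1, posRpow_mul _ ht, Real.rpow_add ht, Real.rpow_sum_of_pos ht]
  simp only [Pi.smul_apply, smul_eq_mul, posRpow_mul _ ht, Finset.prod_mul_distrib]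
  ring

theorem lintegral_dirichletKernel_of_pos {d : ℕ} (α : Fin d → ℝ) (b : ℝ) {t : ℝ} (ht : 0 < t) :
    ∫⁻ φ, ENNReal.ofReal (dirichletKernel α b t φ) =
      ENNReal.ofReal (t ^ (∑ i, α i + b - 1)) *
        ∫⁻ φ, ENNReal.ofReal (dirichletKernel α b 1 φ) := by
  have hm : Measurable fun φ => ENNReal.ofReal (dirichletKernel α b t φ) :=
    ((measurable_dirichletKernel α b).comp (measurable_const.prodMk measurable_id)).ennreal_ofReal
  have hm1 : Measurable fun φ => ENNReal.ofReal (dirichletKernel α b 1 φ) :=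
    ((measurable_dirichletKernel α b).comp (measurable_const.prodMk measurable_id)).ennreal_ofReal
  rw [lintegral_comp_smul_pi ht hm]
  have h : ∀ φ, ENNReal.ofReal (dirichletKernel α b t (t • φ)) =
      ENNReal.ofReal (t ^ (∑ i, (α i - 1) + (b - 1))) *
        ENNReal.ofReal (dirichletKernel α b 1 φ) := fun φ => by
    rw [dirichletKernel_smul α b ht, ENNReal.ofReal_mul (by positivity)]
  simp_rw [h]
  rw [lintegral_const_mul _ hm1, ← mul_assoc, ← ENNReal.ofReal_mul (by positivity),
    ← Real.rpow_natCast, ← Real.rpow_add ht]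
  congr 3
  simp only [Finset.sum_sub_distrib, Finset.sum_const, Finset.card_univ, Fintype.card_fin,
    nsmul_eq_mul, mul_one]
  ring_nf

/-- The Dirichlet integral. With `I` its value, `∏ Γ(α i) · Γ(b)` is an integral over `d + 1`
independent variables; taking their sum `t` as the last variable and scaling the others by `t`
turns it into `Γ(∑ α i + b) · I`. -/
theorem lintegral_dirichletKernel {d : ℕ} {α : Fin d → ℝ} (hα : ∀ i, 0 < α i) {b : ℝ}
    (hb : 0 < b) :
    ∫⁻ φ, ENNReal.ofReal (dirichletKernel α b 1 φ) =
      ENNReal.ofReal ((∏ i, Real.Gamma (α i)) * Real.Gamma b / Real.Gamma (∑ i, α i + b)) := by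
  set I := ∫⁻ φ, ENNReal.ofReal (dirichletKernel α b 1 φ)
  have hs : 0 < ∑ i, α i + b :=
    add_pos_of_nonneg_of_pos (Finset.sum_nonneg fun i _ => (hα i).le) hb
  have hG : 0 < Real.Gamma (∑ i, α i + b) := Real.Gamma_pos_of_pos hs
  have hF : Measurable fun p : (Fin d → ℝ) × ℝ =>
      ENNReal.ofReal (dirichletKernel α b p.2 p.1 * Real.exp (-p.2)) := by
    refine ((((measurable_dirichletKernel α b).comp measurable_swap).mul ?_)).ennreal_ofReal
    fun_prop
  have h1 : ∫⁻ φ : Fin d → ℝ, ∫⁻ t, ENNReal.ofReal (dirichletKernel α b t φ * Real.exp (-t)) =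
      ENNReal.ofReal ((∏ i, Real.Gamma (α i)) * Real.Gamma b) := by
    have h2 : ∀ φ : Fin d → ℝ,
        ∫⁻ t, ENNReal.ofReal (dirichletKernel α b t φ * Real.exp (-t)) =
          ENNReal.ofReal (∏ i, (posRpow (α i - 1) (φ i) * Real.exp (-φ i))) *
            ENNReal.ofReal (Real.Gamma b) := by
      intro φ
      rw [← lintegral_add_right_eq_self _ (∑ i, φ i), ← lintegral_posRpow_mul_exp hb,
        ← lintegral_const_mul _ (measurable_posRpow_mul_exp _).ennreal_ofReal]
      refine lintegral_congr fun t => ?_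
      rw [← ENNReal.ofReal_mul (Finset.prod_nonneg fun i _ =>
        mul_nonneg (posRpow_nonneg _ _) (Real.exp_pos _).le)]
      congr 1
      rw [dirichletKernel, add_sub_cancel_right, Finset.prod_mul_distrib, ← Real.exp_sum,
        neg_add, Real.exp_add, Finset.sum_neg_distrib]
      ring
    simp_rw [h2]
    have hint : Integrable fun φ : Fin d → ℝ =>
        ∏ i, (posRpow (α i - 1) (φ i) * Real.exp (-φ i)) :=
      Integrable.fintype_prod (f := fun i t => posRpow (α i - 1) t * Real.exp (-t))
        fun i => integrable_posRpow_mul_exp (hα i)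
    have hnn : ∀ φ : Fin d → ℝ, 0 ≤ ∏ i, (posRpow (α i - 1) (φ i) * Real.exp (-φ i)) :=
      fun φ => Finset.prod_nonneg fun i _ => mul_nonneg (posRpow_nonneg _ _) (Real.exp_pos _).le
    rw [lintegral_mul_const' _ _ ENNReal.ofReal_ne_top,
      ← ofReal_integral_eq_lintegral_ofReal hint (Eventually.of_forall hnn),
      ← ENNReal.ofReal_mul (integral_nonneg hnn),
      integral_fintype_prod_volume_eq_prod (fun i t => posRpow (α i - 1) t * Real.exp (-t))]
    simp_rw [integral_posRpow_mul_exp (hα _)]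
  have h3 : ∫⁻ φ : Fin d → ℝ, ∫⁻ t, ENNReal.ofReal (dirichletKernel α b t φ * Real.exp (-t)) =
      ENNReal.ofReal (Real.Gamma (∑ i, α i + b)) * I := by
    rw [lintegral_lintegral_swap hF.aemeasurable, ← lintegral_posRpow_mul_exp hs,
      ← lintegral_mul_const _ (measurable_posRpow_mul_exp _).ennreal_ofReal]
    refine lintegral_congr fun t => ?_
    rcases le_or_gt t 0 with ht | ht
    · simp [dirichletKernel_of_nonpos α b ht, posRpow_of_nonpos _ ht]
    · simp_rw [ENNReal.ofReal_mul (dirichletKernel_nonneg _ _ _ _)]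
      rw [lintegral_mul_const' _ _ ENNReal.ofReal_ne_top, lintegral_dirichletKernel_of_pos α b ht,
        posRpow_of_pos _ ht, ENNReal.ofReal_mul (by positivity)]
      ring
  rw [ENNReal.ofReal_div_of_pos hG, ← h1, h3, mul_comm, ENNReal.mul_div_cancel_right]
  · exact (ENNReal.ofReal_pos.2 hG).ne'
  · exact ENNReal.ofReal_ne_top

/-- The Krichevsky–Trofimov probability of a string over an `m`-letter alphabet in which the letter
`j` occurs `a j` times: the mean of `∏ j, θ j ^ a j` under the Dirichlet distribution with
parameters `(1/2, …, 1/2)`. -/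
noncomputable def ktProb {m : ℕ} (a : Fin m → ℕ) : ℝ :=
  Real.Gamma ((m : ℝ) / 2) / Real.pi ^ ((m : ℝ) / 2) *
    ((∏ j, Real.Gamma (a j + 1 / 2)) / Real.Gamma (∑ j, (a j : ℝ) + (m : ℝ) / 2))

theorem measurable_ofFree {m : ℕ} : Measurable (ofFree : (Fin (m - 1) → ℝ) → Fin m → ℝ) := by
  refine measurable_pi_lambda _ fun j => ?_
  unfold ofFree
  split_ifs <;> fun_prop

theorem measurableSet_forall_nonneg (d : ℕ) :
    MeasurableSet {φ : Fin d → ℝ | ∀ i, 0 ≤ φ i} := by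
  rw [Set.ofPred_forall]
  exact MeasurableSet.iInter fun i => measurableSet_le measurable_const (measurable_pi_apply i)

theorem measurableSet_freeSimplex (d : ℕ) :
    MeasurableSet {φ : Fin d → ℝ | (∀ i, 0 ≤ φ i) ∧ ∑ i, φ i ≤ 1} := by
  have h : Measurable fun φ : Fin d → ℝ => ∑ i, φ i := by fun_prop
  exact (measurableSet_forall_nonneg d).inter (measurableSet_le h measurable_const)

theorem ofFree_castSucc {d : ℕ} (φ : Fin d → ℝ) (i : Fin d) :
    ofFree (m := d + 1) φ i.castSucc = φ i := by
  simp [ofFree]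

theorem ofFree_last {d : ℕ} (φ : Fin d → ℝ) :
    ofFree (m := d + 1) φ (Fin.last d) = 1 - ∑ i, φ i := by
  simp [ofFree]

theorem pow_mul_rpow_neg_half (k : ℕ) {t : ℝ} (ht : 0 ≤ t) :
    t ^ k * t ^ (-(1 / 2) : ℝ) = posRpow (k + 1 / 2 - 1) t := by
  rcases ht.eq_or_lt with rfl | h
  · rw [posRpow_of_nonpos _ le_rfl, Real.zero_rpow (by norm_num), mul_zero]
  · rw [posRpow_of_pos _ h, ← Real.rpow_natCast, ← Real.rpow_add h]
    congr 1; ring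

theorem lintegral_dirichletHalf {d : ℕ} (a : Fin (d + 1) → ℕ) :
    ∫⁻ θ, ENNReal.ofReal (∏ j, θ j ^ a j) ∂(dirichletHalf (d + 1)) =
      ENNReal.ofReal (ktProb a) := by
  have hm : Measurable fun θ : Fin (d + 1) → ℝ => ENNReal.ofReal (∏ j, θ j ^ a j) := by
    fun_prop
  set S : Set (Fin d → ℝ) := {φ | (∀ i, 0 ≤ φ i) ∧ ∑ i, φ i ≤ 1} with hS
  have hSm : MeasurableSet S := measurableSet_freeSimplex d
  set c : ℝ := Real.Gamma (((d + 1 : ℕ) : ℝ) / 2) / Real.pi ^ (((d + 1 : ℕ) : ℝ) / 2) with hc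
  have hc0 : 0 ≤ c := by
    have : 0 < Real.Gamma (((d + 1 : ℕ) : ℝ) / 2) := Real.Gamma_pos_of_pos (by positivity)
    positivity
  have hdm : Measurable fun φ : Fin d → ℝ => ENNReal.ofReal (c *
      ∏ j : Fin (d + 1), ofFree (m := d + 1) φ j ^ (-(1 / 2) : ℝ)) := by
    refine (measurable_const.mul (Finset.measurable_prod _ fun j _ => ?_)).ennreal_ofReal
    exact ((measurable_pi_apply j).comp measurable_ofFree).pow_const _
  rw [dirichletHalf, lintegral_map hm measurable_ofFree]
  change ∫⁻ φ, _ ∂((volume.restrict S).withDensity fun φ : Fin d → ℝ => ENNReal.ofReal (c *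
      ∏ j : Fin (d + 1), ofFree (m := d + 1) φ j ^ (-(1 / 2) : ℝ))) = _
  rw [lintegral_withDensity_eq_lintegral_mul _ hdm (g := fun φ =>
      ENNReal.ofReal (∏ j, ofFree (m := d + 1) φ j ^ a j)) (hm.comp measurable_ofFree),
    ← lintegral_indicator hSm]
  have key : ∀ φ : Fin d → ℝ, S.indicator ((fun φ => ENNReal.ofReal (c *
      ∏ j : Fin (d + 1), ofFree (m := d + 1) φ j ^ (-(1 / 2) : ℝ))) * fun φ =>
        ENNReal.ofReal (∏ j, ofFree (m := d + 1) φ j ^ a j)) φ =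
      ENNReal.ofReal c * ENNReal.ofReal (dirichletKernel (fun i => a i.castSucc + 1 / 2)
        (a (Fin.last d) + 1 / 2) 1 φ) := by
    intro φ
    by_cases hφ : φ ∈ S
    · have h0 : ∀ j, 0 ≤ ofFree (m := d + 1) φ j := by
        intro j
        induction j using Fin.lastCases with
        | last => rw [ofFree_last]; linarith [hφ.2]
        | cast i => rw [ofFree_castSucc]; exact hφ.1 i
      rw [Set.indicator_of_mem hφ, Pi.mul_apply, ENNReal.ofReal_mul hc0, mul_assoc,
        ← ENNReal.ofReal_mul (Finset.prod_nonneg fun j _ => Real.rpow_nonneg (h0 j) _),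
        ← Finset.prod_mul_distrib]
      congr 2
      rw [dirichletKernel, Fin.prod_univ_castSucc]
      congr 1
      · refine Finset.prod_congr rfl fun i _ => ?_
        rw [mul_comm, pow_mul_rpow_neg_half _ (h0 _), ofFree_castSucc]
      · rw [mul_comm, pow_mul_rpow_neg_half _ (h0 _), ofFree_last]
    · rw [Set.indicator_of_notMem hφ]
      suffices h : dirichletKernel (fun i => (a i.castSucc : ℝ) + 1 / 2)
          (a (Fin.last d) + 1 / 2) 1 φ = 0 by rw [h]; simp
      rw [dirichletKernel]
      by_cases hn : ∀ i, 0 ≤ φ i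
      · have : ¬ ∑ i, φ i ≤ 1 := fun h => hφ ⟨hn, h⟩
        rw [posRpow_of_nonpos (_ + _ - _) (by linarith), mul_zero]
      · push Not at hn
        obtain ⟨i, hi⟩ := hn
        rw [Finset.prod_eq_zero (Finset.mem_univ i) (posRpow_of_nonpos _ hi.le), zero_mul]
  change ∫⁻ φ, S.indicator ((fun φ => ENNReal.ofReal (c *
      ∏ j : Fin (d + 1), ofFree (m := d + 1) φ j ^ (-(1 / 2) : ℝ))) * fun φ =>
        ENNReal.ofReal (∏ j, ofFree (m := d + 1) φ j ^ a j)) φ = _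
  simp_rw [key]
  rw [lintegral_const_mul' _ _ ENNReal.ofReal_ne_top,
    lintegral_dirichletKernel (fun i => by positivity) (by positivity),
    ← ENNReal.ofReal_mul hc0, ktProb, ← hc, Fin.prod_univ_castSucc, Fin.sum_univ_castSucc]
  congr 4
  rw [Finset.sum_add_distrib]
  simp only [Finset.sum_const, Finset.card_univ, Fintype.card_fin, nsmul_eq_mul]
  push_cast
  ring

theorem dirichletHalf_univ (m : ℕ) (hm : 0 < m) : dirichletHalf m Set.univ = 1 := by
  obtain ⟨d, rfl⟩ : ∃ d, m = d + 1 := ⟨m - 1, by omega⟩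
  have h := lintegral_dirichletHalf (d := d) (fun _ => 0)
  simp only [pow_zero, Finset.prod_const_one, ENNReal.ofReal_one, lintegral_one] at h
  rw [h, ktProb]
  simp only [Nat.cast_zero, zero_add, Finset.sum_const_zero, Finset.prod_const, Finset.card_univ,
    Fintype.card_fin]
  rw [Real.Gamma_one_half_eq, Real.sqrt_eq_rpow, ← Real.rpow_natCast, ← Real.rpow_mul
    Real.pi_pos.le]
  have h1 : 0 < Real.Gamma (((d + 1 : ℕ) : ℝ) / 2) := Real.Gamma_pos_of_pos (by positivity)
  have h2 : 0 < Real.pi ^ (((d + 1 : ℕ) : ℝ) / 2) := Real.rpow_pos_of_pos Real.pi_pos _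
  rw [show (1 / 2 : ℝ) * ((d + 1 : ℕ) : ℝ) = ((d + 1 : ℕ) : ℝ) / 2 by ring]
  rw [show ∀ x y : ℝ, 0 < x → 0 < y → x / y * (y / x) = 1 from fun x y hx hy => by field_simp]
  · simp
  · exact h1
  · exact h2

theorem isProbabilityMeasure_dirichletHalf {m : ℕ} (hm : 0 < m) :
    IsProbabilityMeasure (dirichletHalf m) :=
  ⟨dirichletHalf_univ m hm⟩

theorem ktProb_pos {m : ℕ} (hm : 0 < m) (a : Fin m → ℕ) : 0 < ktProb a := by
  have hm' : (0 : ℝ) < m := by exact_mod_cast hm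
  have h1 : 0 < Real.Gamma ((m : ℝ) / 2) := Real.Gamma_pos_of_pos (by positivity)
  have h2 : 0 < ∏ j, Real.Gamma (a j + 1 / 2) :=
    Finset.prod_pos fun j _ => Real.Gamma_pos_of_pos (by positivity)
  have h3 : 0 < Real.Gamma (∑ j, (a j : ℝ) + (m : ℝ) / 2) := Real.Gamma_pos_of_pos (by positivity)
  unfold ktProb
  positivity

theorem ae_nonneg_dirichletHalf (d : ℕ) : ∀ᵐ θ ∂(dirichletHalf (d + 1)), ∀ j, 0 ≤ θ j := by
  rw [dirichletHalf, ae_map_iff measurable_ofFree.aemeasurable]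
  · refine (withDensity_absolutelyContinuous _ _).ae_le ?_
    refine (ae_restrict_iff' (measurableSet_freeSimplex d)).2 (Eventually.of_forall fun φ hφ j => ?_)
    induction j using Fin.lastCases with
    | last => rw [ofFree_last]; linarith [hφ.2]
    | cast i => rw [ofFree_castSucc]; exact hφ.1 i
  · exact measurableSet_forall_nonneg (d + 1)

theorem integral_dirichletHalf {m : ℕ} (hm : 0 < m) (a : Fin m → ℕ) :
    ∫ θ, ∏ j, θ j ^ a j ∂(dirichletHalf m) = ktProb a := by
  obtain ⟨d, rfl⟩ : ∃ d, m = d + 1 := ⟨m - 1, by omega⟩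
  rw [integral_eq_lintegral_of_nonneg_ae, lintegral_dirichletHalf,
    ENNReal.toReal_ofReal (ktProb_pos hm a).le]
  · filter_upwards [ae_nonneg_dirichletHalf d] with θ hθ
    exact Finset.prod_nonneg fun j _ => pow_nonneg (hθ j) _
  · exact (Measurable.aestronglyMeasurable (by fun_prop))

/-- The marginal likelihood of a model is the product over its leaves of the
Krichevsky–Trofimov probabilities. -/
theorem marginal_eq_prod_ktProb {m D : ℕ} (hm : 0 < m) (x : ℕ → Fin m) (n : ℕ) (T : Model m D) :
    marginal x n T = ∏ s : T.leaves, ktProb (count D x n s.1) := by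
  have := isProbabilityMeasure_dirichletHalf hm
  unfold marginal likelihood paramPrior
  rw [integral_fintype_prod_eq_prod (fun (s : T.leaves) (θ : Fin m → ℝ) =>
    ∏ j, θ j ^ count D x n s.1 j)]
  exact Finset.prod_congr rfl fun s _ => integral_dirichletHalf hm _

/-! ### Stirling bounds for Krichevsky–Trofimov probabilities -/

theorem exists_abs_log_factorial_sub_le : ∃ C : ℝ, ∀ n : ℕ,
    |Real.log (n.factorial) - (n * Real.log n - n + 1 / 2 * Real.log (n + 1))| ≤ C := by
  refine ⟨|Real.log (√Real.pi)| + |Real.log (Stirling.stirlingSeq 1)| + Real.log 2, fun n => ?_⟩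
  have hl2 : 0 ≤ Real.log 2 := Real.log_nonneg (by norm_num)
  rcases n with _ | n
  · simp; positivity
  · set k : ℕ := n + 1 with hk
    have hk0 : (0 : ℝ) < k := by positivity
    have hk1 : (1 : ℝ) ≤ k := by rw [hk]; push_cast; linarith [(Nat.cast_nonneg n : (0 : ℝ) ≤ n)]
    have h1 := Stirling.log_stirlingSeq_formula k
    have h2 : Real.log (√Real.pi) ≤ Real.log (Stirling.stirlingSeq k) :=
      Real.log_le_log (by positivity) (Stirling.sqrt_pi_le_stirlingSeq (by omega))
    have h3 : Real.log (Stirling.stirlingSeq k) ≤ Real.log (Stirling.stirlingSeq 1) :=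
      Real.log_le_log (Stirling.stirlingSeq'_pos n) (Stirling.stirlingSeq'_antitone (Nat.zero_le n))
    rw [Real.log_div hk0.ne' (Real.exp_pos 1).ne', Real.log_exp,
      Real.log_mul (by norm_num) hk0.ne'] at h1
    have h4 : Real.log k ≤ Real.log (k + 1) := Real.log_le_log hk0 (by linarith)
    have h5 : Real.log (k + 1) ≤ Real.log 2 + Real.log k := by
      rw [← Real.log_mul (by norm_num) hk0.ne']
      exact Real.log_le_log (by positivity) (by linarith)
    have h6 := neg_abs_le (Real.log (√Real.pi))
    have h7 := le_abs_self (Real.log (Stirling.stirlingSeq 1))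
    have h8 := abs_nonneg (Real.log (√Real.pi))
    have h9 := abs_nonneg (Real.log (Stirling.stirlingSeq 1))
    rw [abs_le]
    constructor <;> nlinarith

/-- By log-convexity of the Gamma function, `Γ(n + 1/2)` is `n! / √(n + 1)` up to a constant. -/
theorem abs_log_Gamma_add_half_sub_le (n : ℕ) :
    |Real.log (Real.Gamma (n + 1 / 2)) -
      (Real.log (n.factorial) - 1 / 2 * Real.log (n + 1))| ≤ Real.log 2 := by
  have hn : (0 : ℝ) ≤ n := Nat.cast_nonneg n
  have hl2 : 0 ≤ Real.log 2 := Real.log_nonneg (by norm_num)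
  have hconv := Real.convexOn_log_Gamma.2
  have hmid : ∀ x y : ℝ, 0 < x → 0 < y → Real.log (Real.Gamma ((x + y) / 2)) ≤
      1 / 2 * Real.log (Real.Gamma x) + 1 / 2 * Real.log (Real.Gamma y) := by
    intro x y hx hy
    have h := hconv (Set.mem_Ioi.2 hx) (Set.mem_Ioi.2 hy) (by norm_num : (0 : ℝ) ≤ 1 / 2)
      (by norm_num : (0 : ℝ) ≤ 1 / 2) (by norm_num)
    simp only [smul_eq_mul, Function.comp_apply] at h
    rwa [show 1 / 2 * x + 1 / 2 * y = (x + y) / 2 by ring] at h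
  have hstep : ∀ x : ℝ, 0 < x →
      Real.log (Real.Gamma (x + 1)) = Real.log x + Real.log (Real.Gamma x) := by
    intro x hx
    rw [Real.Gamma_add_one hx.ne', Real.log_mul hx.ne' (Real.Gamma_pos_of_pos hx).ne']
  have e1 := hmid (n + 1 / 2) (n + 1 / 2 + 1) (by positivity) (by positivity)
  rw [hstep _ (by positivity), show ((n : ℝ) + 1 / 2 + (n + 1 / 2 + 1)) / 2 = n + 1 by ring,
    Real.Gamma_nat_eq_factorial] at e1
  have e2 := hmid (n + 1) (n + 1 + 1) (by positivity) (by positivity)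
  rw [hstep (n + 1) (by positivity), Real.Gamma_nat_eq_factorial,
    show ((n : ℝ) + 1 + (n + 1 + 1)) / 2 = n + 1 / 2 + 1 by ring, hstep _ (by positivity)] at e2
  have e3 : Real.log (n + 1 / 2) ≤ Real.log (n + 1) :=
    Real.log_le_log (by positivity) (by linarith)
  have e4 : Real.log (n + 1) ≤ Real.log 2 + Real.log (n + 1 / 2) := by
    rw [← Real.log_mul (by norm_num) (by positivity)]
    exact Real.log_le_log (by positivity) (by linarith)
  rw [abs_le]
  constructor <;> linarith

/-- Stirling's formula for `Γ(n + (m + 1) / 2)`, by the recursion `m ↦ m + 2` from the cases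
`m = 0` and `m = 1`. -/
theorem exists_abs_log_Gamma_sub_le : ∀ m : ℕ, ∃ C : ℝ, ∀ n : ℕ,
    |Real.log (Real.Gamma (n + ((m + 1 : ℕ) : ℝ) / 2)) -
      (n * Real.log n - n + (m : ℝ) / 2 * Real.log (n + 1))| ≤ C
  | 0 => by
    obtain ⟨C, hC⟩ := exists_abs_log_factorial_sub_le
    refine ⟨C + Real.log 2, fun n => ?_⟩
    have h1 := abs_le.1 (hC n)
    have h2 := abs_le.1 (abs_log_Gamma_add_half_sub_le n)
    rw [abs_le]
    simp only [zero_add, Nat.cast_one, Nat.cast_zero, zero_div, zero_mul, add_zero]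
    constructor <;> linarith
  | 1 => by
    obtain ⟨C, hC⟩ := exists_abs_log_factorial_sub_le
    refine ⟨C, fun n => ?_⟩
    have h1 := hC n
    rw [← Real.Gamma_nat_eq_factorial] at h1
    norm_num at h1 ⊢
    exact h1
  | m + 2 => by
    obtain ⟨C, hC⟩ := exists_abs_log_Gamma_sub_le m
    refine ⟨C + Real.log (m + 2), fun n => ?_⟩
    have hn : (0 : ℝ) ≤ n := Nat.cast_nonneg n
    have hm : (0 : ℝ) ≤ m := Nat.cast_nonneg m
    have h1 := abs_le.1 (hC n)
    have hx : (0 : ℝ) < n + ((m + 1 : ℕ) : ℝ) / 2 := by positivity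
    have h2 : Real.log (Real.Gamma (n + ((m + 2 + 1 : ℕ) : ℝ) / 2)) =
        Real.log (n + ((m + 1 : ℕ) : ℝ) / 2) +
          Real.log (Real.Gamma (n + ((m + 1 : ℕ) : ℝ) / 2)) := by
      rw [← Real.log_mul hx.ne' (Real.Gamma_pos_of_pos hx).ne', ← Real.Gamma_add_one hx.ne']
      congr 2
      push_cast
      ring
    have h3 : Real.log (n + ((m + 1 : ℕ) : ℝ) / 2) ≤ Real.log (m + 2) + Real.log (n + 1) := by
      rw [← Real.log_mul (by positivity) (by positivity)]
      refine Real.log_le_log hx ?_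
      push_cast
      nlinarith
    have h4 : Real.log (n + 1) ≤ Real.log (m + 2) + Real.log (n + ((m + 1 : ℕ) : ℝ) / 2) := by
      rw [← Real.log_mul (by positivity) hx.ne']
      refine Real.log_le_log (by positivity) ?_
      push_cast
      nlinarith
    rw [h2, abs_le]
    push_cast at *
    constructor <;> nlinarith

/-- The logarithm of the maximal likelihood `∏ j, (a j / n) ^ a j`, with `n = ∑ j, a j`, of a
string in which the letter `j` occurs `a j` times. -/
noncomputable def logMaxLik {m : ℕ} (a : Fin m → ℕ) : ℝ :=
  ∑ j, (a j : ℝ) * Real.log (a j) - (∑ j, a j : ℕ) * Real.log (∑ j, a j : ℕ)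

/-- Up to a bounded error, the logarithm of the Krichevsky–Trofimov probability is the maximal
log-likelihood with the penalty `(m - 1) / 2 * log n` for `m - 1` free parameters. -/
theorem exists_abs_log_ktProb_sub_le {m : ℕ} (hm : 0 < m) : ∃ C : ℝ, ∀ a : Fin m → ℕ,
    |Real.log (ktProb a) -
      (logMaxLik a - ((m : ℝ) - 1) / 2 * Real.log ((∑ j, a j : ℕ) + 1))| ≤ C := by
  obtain ⟨C₁, h₁⟩ := exists_abs_log_Gamma_sub_le 0
  obtain ⟨d, rfl⟩ : ∃ d, m = d + 1 := ⟨m - 1, by omega⟩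
  obtain ⟨C₂, h₂⟩ := exists_abs_log_Gamma_sub_le d
  set c : ℝ := Real.Gamma (((d + 1 : ℕ) : ℝ) / 2) / Real.pi ^ (((d + 1 : ℕ) : ℝ) / 2) with hc
  have hc0 : 0 < c := by
    have : 0 < Real.Gamma (((d + 1 : ℕ) : ℝ) / 2) := Real.Gamma_pos_of_pos (by positivity)
    positivity
  refine ⟨|Real.log c| + (d + 1 : ℕ) * C₁ + C₂, fun a => ?_⟩
  have hG : ∀ j, 0 < Real.Gamma (a j + 1 / 2) := fun j => Real.Gamma_pos_of_pos (by positivity)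
  have hS : 0 < Real.Gamma ((∑ j, a j : ℕ) + ((d + 1 : ℕ) : ℝ) / 2) :=
    Real.Gamma_pos_of_pos (by positivity)
  have hlog : Real.log (ktProb a) = Real.log c + (∑ j, Real.log (Real.Gamma (a j + 1 / 2)) -
      Real.log (Real.Gamma ((∑ j, a j : ℕ) + ((d + 1 : ℕ) : ℝ) / 2))) := by
    rw [ktProb, ← hc, ← Nat.cast_sum, Real.log_mul hc0.ne'
      (div_pos (Finset.prod_pos fun j _ => hG j) hS).ne',
      Real.log_div (Finset.prod_pos fun j _ => hG j).ne' hS.ne',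
      Real.log_prod (fun j _ => (hG j).ne')]
  have hsum : |∑ j, Real.log (Real.Gamma (a j + 1 / 2)) -
      ∑ j, ((a j : ℝ) * Real.log (a j) - a j)| ≤ (d + 1 : ℕ) * C₁ := by
    rw [← Finset.sum_sub_distrib]
    refine (Finset.abs_sum_le_sum_abs _ _).trans ?_
    calc _ ≤ ∑ _j : Fin (d + 1), C₁ := Finset.sum_le_sum fun j _ => by simpa using h₁ (a j)
      _ = _ := by simp
  rw [Finset.sum_sub_distrib, ← Nat.cast_sum] at hsum
  have h2 := abs_le.1 (h₂ (∑ j, a j))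
  have h1 := abs_le.1 hsum
  have h3 := neg_abs_le (Real.log c)
  have h4 := le_abs_self (Real.log c)
  rw [hlog, logMaxLik, abs_le]
  have h5 : (((d + 1 : ℕ) : ℝ) - 1) / 2 = (d : ℝ) / 2 := by push_cast; ring
  rw [h5]
  constructor <;> linarith

/-! ### Information inequalities for counts -/

/-- Gibbs' inequality with a quadratic remainder. It is the sum over `j` of
`x log (x / y) ≥ x - y + (x - y)² / 4` for `x, y ∈ [0, 1]`, which follows from
`log u ≤ 2 (√u - 1)`. -/
theorem sum_mul_log_add_le_logMaxLik {m : ℕ} (a : Fin m → ℕ) {θ : Fin m → ℝ}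
    (hθ : θ ∈ stdSimplex ℝ (Fin m)) (h0 : ∀ j, θ j = 0 → a j = 0) :
    ∑ j, (a j : ℝ) * Real.log (θ j) +
      (∑ j, a j : ℕ) / 4 * ∑ j, ((a j : ℝ) / (∑ j, a j : ℕ) - θ j) ^ 2 ≤ logMaxLik a := by
  set n : ℕ := ∑ j, a j with hn
  rcases Nat.eq_zero_or_pos n with h | h
  · have : ∀ j, a j = 0 := by simpa [h] using hn.symm
    simp [logMaxLik, this, h]
  have hn0 : (0 : ℝ) < n := by exact_mod_cast h
  have haux : ∀ x y : ℝ, 0 ≤ x → x ≤ 1 → 0 ≤ y → y ≤ 1 → (y = 0 → x = 0) →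
      x * Real.log y + (x - y) + 1 / 4 * (x - y) ^ 2 ≤ x * Real.log x := by
    intro x y hx hx1 hy hy1 hxy
    have hsx := Real.sq_sqrt hx
    have hsy := Real.sq_sqrt hy
    have hx2 : √x ≤ 1 := Real.sqrt_le_one.2 hx1
    have hy2 : √y ≤ 1 := Real.sqrt_le_one.2 hy1
    have hx3 := Real.sqrt_nonneg x
    have hy3 := Real.sqrt_nonneg y
    have hsq : 1 / 4 * (x - y) ^ 2 ≤ (√x - √y) ^ 2 := by
      have : x - y = (√x - √y) * (√x + √y) := by nlinarith
      rw [this, mul_pow]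
      have : (√x + √y) ^ 2 ≤ 4 := by nlinarith
      nlinarith [sq_nonneg (√x - √y)]
    rcases hx.eq_or_lt with rfl | hx0
    · nlinarith
    · have hy0 : 0 < y := hy.lt_of_ne fun h => hx0.ne' (hxy h.symm)
      have h1 : Real.log y - Real.log x = 2 * Real.log (√y / √x) := by
        rw [Real.log_div (Real.sqrt_pos.2 hy0).ne' (Real.sqrt_pos.2 hx0).ne',
          Real.log_sqrt hy, Real.log_sqrt hx]
        ring
      have h2 : Real.log (√y / √x) ≤ √y / √x - 1 :=
        Real.log_le_sub_one_of_pos (div_pos (Real.sqrt_pos.2 hy0) (Real.sqrt_pos.2 hx0))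
      have h3 : x * (√y / √x) = √x * √y := by
        have := (Real.sqrt_pos.2 hx0).ne'
        field_simp
        rw [hsx]
      nlinarith [mul_le_mul_of_nonneg_left h2 hx]
  have hle : ∀ j, (a j : ℝ) ≤ n := fun j => by
    exact_mod_cast Finset.single_le_sum (f := a) (fun _ _ => Nat.zero_le _) (Finset.mem_univ j)
  have hterm : ∀ j, (a j : ℝ) * Real.log (θ j) + (a j - n * θ j) +
      n / 4 * ((a j : ℝ) / n - θ j) ^ 2 ≤ a j * Real.log (a j) - a j * Real.log n := by
    intro j
    have h1 := haux (a j / n) (θ j) (by positivity) ((div_le_one hn0).2 (hle j)) (hθ.1 j)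
      (hθ.2 ▸ Finset.single_le_sum (f := θ) (fun i _ => hθ.1 i) (Finset.mem_univ j))
      (fun h => by simp [h0 j h])
    have h2 := mul_le_mul_of_nonneg_left h1 hn0.le
    have h3 : (n : ℝ) * (a j / n) = a j := by field_simp
    rcases Nat.eq_zero_or_pos (a j) with h4 | h4
    · simp only [h4, Nat.cast_zero, zero_div, zero_mul, zero_sub, mul_zero] at h2 ⊢
      linarith
    · have h5 : (0 : ℝ) < a j := by exact_mod_cast h4
      rw [Real.log_div h5.ne' hn0.ne'] at h2
      linear_combination
        h2 - (Real.log (θ j) + 1 - Real.log (a j) + Real.log n) * h3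
  have := Finset.sum_le_sum fun j (_ : j ∈ Finset.univ) => hterm j
  rw [Finset.sum_add_distrib, Finset.sum_add_distrib, Finset.sum_sub_distrib,
    Finset.sum_sub_distrib, ← Finset.mul_sum, ← Finset.mul_sum, ← Finset.sum_mul, hθ.2,
    ← Nat.cast_sum, ← hn] at this
  rw [logMaxLik, ← hn]
  linarith

theorem sum_mul_log_le_logMaxLik {m : ℕ} (a : Fin m → ℕ) {θ : Fin m → ℝ}
    (hθ : θ ∈ stdSimplex ℝ (Fin m)) (h0 : ∀ j, θ j = 0 → a j = 0) :
    ∑ j, (a j : ℝ) * Real.log (θ j) ≤ logMaxLik a := by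
  refine le_trans (le_add_of_nonneg_right ?_) (sum_mul_log_add_le_logMaxLik a hθ h0)
  exact mul_nonneg (by positivity) (Finset.sum_nonneg fun j _ => sq_nonneg _)

/-- The maximal log-likelihood exceeds the true one by at most the `χ²` statistic. The division
by `θ j = 0` is harmless: the corresponding summands vanish. -/
theorem logMaxLik_le_add_chiSq {m : ℕ} (a : Fin m → ℕ) {θ : Fin m → ℝ}
    (hθ : θ ∈ stdSimplex ℝ (Fin m)) (h0 : ∀ j, θ j = 0 → a j = 0) (hn : 0 < ∑ j, a j) :
    logMaxLik a ≤ ∑ j, (a j : ℝ) * Real.log (θ j) +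
      ∑ j, ((a j : ℝ) - (∑ j, a j : ℕ) * θ j) ^ 2 / ((∑ j, a j : ℕ) * θ j) := by
  set n : ℕ := ∑ j, a j with hn'
  have hn0 : (0 : ℝ) < n := by exact_mod_cast hn
  have hterm : ∀ j, (a j : ℝ) * Real.log (a j) - a j * Real.log n + (n * θ j - a j) ≤
      a j * Real.log (θ j) + ((a j : ℝ) - n * θ j) ^ 2 / (n * θ j) := by
    intro j
    rcases (hθ.1 j).eq_or_lt with h | h
    · simp [h0 j h.symm, ← h]
    · rcases Nat.eq_zero_or_pos (a j) with h4 | h4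
      · simp only [h4, Nat.cast_zero, zero_mul, sub_zero, zero_sub, zero_add, neg_sq]
        rw [sq, mul_div_cancel_right₀ _ (mul_pos hn0 h).ne']
      · have h5 : (0 : ℝ) < a j := by exact_mod_cast h4
        have hp : 0 < n * θ j := mul_pos hn0 h
        have h6 := Real.log_le_sub_one_of_pos (div_pos h5 hp)
        rw [Real.log_div h5.ne' hp.ne', Real.log_mul hn0.ne' h.ne'] at h6
        have h7 : ((a j : ℝ) - n * θ j) ^ 2 / (n * θ j) =
            a j * (a j / (n * θ j) - 1) - a j + n * θ j := by
          field_simp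
          ring
        rw [h7]
        nlinarith [mul_le_mul_of_nonneg_left h6 h5.le]
  have := Finset.sum_le_sum fun j (_ : j ∈ Finset.univ) => hterm j
  rw [Finset.sum_add_distrib, Finset.sum_add_distrib, Finset.sum_sub_distrib,
    Finset.sum_sub_distrib, ← Finset.mul_sum, ← Finset.sum_mul, hθ.2, ← Nat.cast_sum, ← hn'] at this
  rw [logMaxLik, ← hn']
  linarith

theorem exists_log_ktProb_le {m : ℕ} (hm : 0 < m) : ∃ C : ℝ, ∀ a : Fin m → ℕ,
    Real.log (ktProb a) ≤ logMaxLik a + C := by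
  obtain ⟨C, hC⟩ := exists_abs_log_ktProb_sub_le hm
  refine ⟨C, fun a => ?_⟩
  have h1 := (abs_le.1 (hC a)).2
  have h2 : 0 ≤ ((m : ℝ) - 1) / 2 * Real.log ((∑ j, a j : ℕ) + 1) := by
    have : (1 : ℝ) ≤ m := by exact_mod_cast hm
    have := Real.log_nonneg (show (1 : ℝ) ≤ (∑ j, a j : ℕ) + 1 by
      linarith [(Nat.cast_nonneg (∑ j, a j) : (0 : ℝ) ≤ (∑ j, a j : ℕ))])
    exact mul_nonneg (by linarith) this
  linarith

/-- Merging the counts `a z`, `z ∈ Z`, lowers the maximal log-likelihood, and linearly so if two of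
the merged counts have different frequencies of some letter `j`. -/
theorem logMaxLik_sum_add_le {m : ℕ} {ι : Type*} [DecidableEq ι] (Z : Finset ι)
    (a : ι → Fin m → ℕ) {z z' : ι} (hz : z ∈ Z) (hz' : z' ∈ Z) (j : Fin m) {c : ℝ}
    (hc : c ≤ (∑ j, a z j : ℕ)) (hc' : c ≤ (∑ j, a z' j : ℕ)) (hc0 : 0 < c) :
    logMaxLik (fun j => ∑ w ∈ Z, a w j) +
      c / 8 * ((a z j : ℝ) / (∑ j, a z j : ℕ) - (a z' j : ℝ) / (∑ j, a z' j : ℕ)) ^ 2 ≤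
        ∑ w ∈ Z, logMaxLik (a w) := by
  set A : Fin m → ℕ := fun j => ∑ w ∈ Z, a w j with hA
  set n : ℕ := ∑ j, A j with hn
  have haz : ∀ w ∈ Z, ∀ j, a w j ≤ A j := fun w hw j =>
    Finset.single_le_sum (f := fun w => a w j) (fun _ _ => Nat.zero_le _) hw
  have hnpos : (0 : ℝ) < n := by
    have h1 : ∑ j, a z j ≤ n := Finset.sum_le_sum fun j _ => haz z hz j
    have : ((∑ j, a z j : ℕ) : ℝ) ≤ n := by exact_mod_cast h1
    linarith
  set q : Fin m → ℝ := fun j => A j / n with hq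
  have hqs : q ∈ stdSimplex ℝ (Fin m) := by
    refine ⟨fun j => by positivity, ?_⟩
    rw [← Finset.sum_div, ← Nat.cast_sum, ← hn, div_self hnpos.ne']
  have hq0 : ∀ w ∈ Z, ∀ j, q j = 0 → a w j = 0 := by
    intro w hw j h
    have : A j = 0 := by simpa [hq, hnpos.ne'] using h
    have := haz w hw j
    omega
  have hg : ∀ w ∈ Z, ∑ j, (a w j : ℝ) * Real.log (q j) +
      (∑ j, a w j : ℕ) / 4 * ((a w j : ℝ) / (∑ j, a w j : ℕ) - q j) ^ 2 ≤ logMaxLik (a w) := by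
    intro w hw
    refine le_trans ?_ (sum_mul_log_add_le_logMaxLik (a w) hqs (hq0 w hw))
    gcongr
    exact Finset.single_le_sum (f := fun j => ((a w j : ℝ) / (∑ j, a w j : ℕ) - q j) ^ 2)
      (fun i _ => sq_nonneg _) (Finset.mem_univ j)
  have hML : ∑ w ∈ Z, ∑ j, (a w j : ℝ) * Real.log (q j) = logMaxLik A := by
    rw [Finset.sum_comm, logMaxLik, ← hn, hn, Nat.cast_sum, Finset.sum_mul,
      ← Finset.sum_sub_distrib]
    refine Finset.sum_congr rfl fun i _ => ?_
    rw [← Finset.sum_mul, ← Nat.cast_sum, ← Nat.cast_sum, ← hn]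
    change (A i : ℝ) * Real.log (A i / n) = _
    rcases Nat.eq_zero_or_pos (A i) with h | h
    · simp [h]
    · rw [Real.log_div (by exact_mod_cast h.ne') hnpos.ne']
      ring
  have hsum := Finset.sum_le_sum hg
  rw [Finset.sum_add_distrib, hML] at hsum
  refine le_trans ?_ hsum
  gcongr
  by_cases hzz : z = z'
  · subst hzz
    simp only [sub_self]
    have : 0 ≤ ∑ i ∈ Z, ((∑ j, a i j : ℕ) : ℝ) / 4 *
        ((a i j : ℝ) / (∑ j, a i j : ℕ) - q j) ^ 2 :=
      Finset.sum_nonneg fun i _ => by positivity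
    simpa using this
  · have hpair := Finset.sum_le_sum_of_subset_of_nonneg
      (f := fun i => ((∑ j, a i j : ℕ) : ℝ) / 4 * ((a i j : ℝ) / (∑ j, a i j : ℕ) - q j) ^ 2)
      (show {z, z'} ⊆ Z from by
        intro w hw
        rcases Finset.mem_insert.1 hw with rfl | hw
        · exact hz
        · rwa [Finset.mem_singleton.1 hw])
      (fun i _ _ => by positivity)
    rw [Finset.sum_pair hzz] at hpair
    refine le_trans ?_ hpair
    set u := (a z j : ℝ) / (∑ j, a z j : ℕ)
    set v := (a z' j : ℝ) / (∑ j, a z' j : ℕ)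
    calc c / 8 * (u - v) ^ 2 ≤ c / 4 * (u - q j) ^ 2 + c / 4 * (v - q j) ^ 2 := by
          nlinarith [mul_nonneg hc0.le (sq_nonneg (u - q j + (v - q j)))]
      _ ≤ _ := by gcongr

/-! ### Nonnegative supermartingales along the chain -/

section Chain

variable {m D : ℕ} {Ω : Type*} {X : ℕ → Ω → Fin m}

/-- The event that the first `N` symbols agree with those of `x`. -/
def cylinder (X : ℕ → Ω → Fin m) (N : ℕ) (x : ℕ → Fin m) : Set Ω := {ω | ∀ k < N, X k ω = x k}

/-- A finite string, continued arbitrarily. -/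
def extend (hm : 0 < m) {N : ℕ} (f : Fin N → Fin m) (k : ℕ) : Fin m :=
  if h : k < N then f ⟨k, h⟩ else ⟨0, hm⟩

theorem mem_cylinder_extend_iff (hm : 0 < m) {N : ℕ} (f : Fin N → Fin m) (ω : Ω) :
    ω ∈ cylinder X N (extend hm f) ↔ (fun k : Fin N => X k ω) = f := by
  constructor
  · intro h
    funext k
    have := h k k.2
    simpa [extend] using this
  · rintro rfl k hk
    simp [extend, hk]

variable [MeasurableSpace Ω] {μ : Measure Ω} {T : Model m D} {θ : T.Params}

theorem IsChain.measurableSet_cylinder (hX : IsChain μ X T θ) (N : ℕ) (x : ℕ → Fin m) :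
    MeasurableSet (cylinder X N x) := by
  have : cylinder X N x = ⋂ k, ⋂ _ : k < N, X k ⁻¹' {x k} := by
    ext ω; simp [cylinder]
  rw [this]
  exact MeasurableSet.iInter fun k => MeasurableSet.iInter fun _ =>
    hX.measurable k (measurableSet_singleton _)

/-- The filtration generated by the chain. -/
def IsChain.filtration (hX : IsChain μ X T θ) :
    Filtration ℕ (inferInstance : MeasurableSpace Ω) where
  seq n := MeasurableSpace.comap (fun ω (k : Fin (D + n)) => X k ω) ⊤
  mono' := by
    intro i j hij
    rw [← measurable_iff_comap_le]
    have h : (fun ω (k : Fin (D + i)) => X k ω) =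
        (fun (f : Fin (D + j) → Fin m) (k : Fin (D + i)) => f ⟨k, by omega⟩) ∘
          fun ω (k : Fin (D + j)) => X k ω := rfl
    rw [h]
    exact (@measurable_from_top _ _ ⊤ _).comp (comap_measurable _)
  le' := by
    intro i
    rw [← measurable_iff_comap_le]
    have : Measurable fun ω (k : Fin (D + i)) => X k ω :=
      measurable_pi_lambda _ fun k => hX.measurable k
    intro s _
    exact this (Set.toFinite s).measurableSet

theorem window_congr {x y : ℕ → Fin m} {n : ℕ} (h : ∀ k < D + n, x k = y k) {i : ℕ} (hi : i ≤ n) :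
    window D x i = window D y i := by
  funext k
  exact h _ (by omega)

theorem IsChain.setIntegral_cylinder_succ_le (hX : IsChain μ X T θ) [IsProbabilityMeasure μ]
    {L : ℕ → (ℕ → Fin m) → ℝ}
    (hdep : ∀ n x y, (∀ k < D + n, x k = y k) → L n x = L n y)
    (hstep : ∀ n x, ∑ a, stepProb T θ (window D x n) a *
      L (n + 1) (Function.update x (D + n) a) ≤ L n x)
    (hint : ∀ n, Integrable (fun ω => L n fun k => X k ω) μ) (n : ℕ) (x : ℕ → Fin m) :
    ∫ ω in cylinder X (D + n) x, L (n + 1) (fun k => X k ω) ∂μ ≤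
      ∫ ω in cylinder X (D + n) x, L n (fun k => X k ω) ∂μ := by
  have hconst : ∀ n x, ∫ ω in cylinder X (D + n) x, L n (fun k => X k ω) ∂μ =
      μ.real (cylinder X (D + n) x) * L n x := by
    intro n x
    rw [setIntegral_congr_fun (hX.measurableSet_cylinder _ _)
      (g := fun _ => L n x) (fun ω hω => hdep n _ _ hω), setIntegral_const, smul_eq_mul]
  have hU : cylinder X (D + n) x =
      ⋃ a, cylinder X (D + (n + 1)) (Function.update x (D + n) a) := by
    ext ω
    simp only [cylinder, Set.mem_iUnion, Set.mem_ofPred_eq]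
    constructor
    · intro h
      refine ⟨X (D + n) ω, fun k hk => ?_⟩
      rcases eq_or_ne k (D + n) with rfl | hne
      · simp
      · rw [Function.update_of_ne hne]; exact h k (by omega)
    · rintro ⟨a, h⟩ k hk
      have := h k (by omega)
      rwa [Function.update_of_ne (by omega)] at this
  have hdisj : Pairwise (Function.onFun Disjoint
      fun a => cylinder X (D + (n + 1)) (Function.update x (D + n) a)) := by
    intro a b hab
    rw [Function.onFun, Set.disjoint_left]
    intro ω ha hb
    have h1 := ha (D + n) (by omega)
    have h2 := hb (D + n) (by omega)
    rw [Function.update_self] at h1 h2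
    exact hab (h1.symm.trans h2)
  rw [hconst]
  rw [hU, integral_iUnion_fintype (fun a => hX.measurableSet_cylinder _ _) hdisj
    (fun a => (hint (n + 1)).integrableOn), ← hU]
  have hreal : ∀ a, μ.real (cylinder X (D + (n + 1)) (Function.update x (D + n) a)) =
      μ.real (cylinder X (D + n) x) * stepProb T θ (window D x n) a := by
    intro a
    have h := hX.step n (Function.update x (D + n) a)
    rw [Function.update_self, window_congr (n := n) (y := x)
      (fun k hk => Function.update_of_ne (by omega) _ _) le_rfl] at h
    have h2 : {ω | ∀ k < D + n, X k ω = Function.update x (D + n) a k} =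
        cylinder X (D + n) x := by
      ext ω
      refine forall_congr' fun k => forall_congr' fun hk => ?_
      rw [Function.update_of_ne (by omega)]
    rw [h2] at h
    exact h
  simp_rw [hconst (n + 1), hreal, mul_assoc]
  rw [← Finset.mul_sum]
  exact mul_le_mul_of_nonneg_left (hstep n x) measureReal_nonneg

theorem IsChain.measurable_of_dependsOn (hX : IsChain μ X T θ) (hm : 0 < m)
    {L : (ℕ → Fin m) → ℝ} {n : ℕ} (hdep : ∀ x y, (∀ k < D + n, x k = y k) → L x = L y) :
    Measurable[hX.filtration n] fun ω => L fun k => X k ω := by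
  have h : (fun ω => L fun k => X k ω) =
      (fun f : Fin (D + n) → Fin m => L (extend hm f)) ∘ fun ω (k : Fin (D + n)) => X k ω := by
    funext ω
    refine hdep _ _ fun k hk => ?_
    simp [extend, hk]
  rw [h]
  exact (@measurable_from_top _ _ _ _).comp (comap_measurable _)

theorem IsChain.integrable_of_dependsOn (hX : IsChain μ X T θ) [IsProbabilityMeasure μ]
    (hm : 0 < m) {L : (ℕ → Fin m) → ℝ} {n : ℕ}
    (hdep : ∀ x y, (∀ k < D + n, x k = y k) → L x = L y) :
    Integrable (fun ω => L fun k => X k ω) μ := by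
  refine Integrable.of_bound
    ((hX.measurable_of_dependsOn hm hdep).mono (hX.filtration.le n) le_rfl).aestronglyMeasurable
    (∑ f : Fin (D + n) → Fin m, |L (extend hm f)|) (Eventually.of_forall fun ω => ?_)
  have : L (fun k => X k ω) = L (extend hm fun k : Fin (D + n) => X k ω) :=
    hdep _ _ fun k hk => by simp [extend, hk]
  rw [this, Real.norm_eq_abs]
  exact Finset.single_le_sum (f := fun f : Fin (D + n) → Fin m => |L (extend hm f)|)
    (fun f _ => abs_nonneg _) (Finset.mem_univ _)

/-- A nonnegative function of the past which does not increase in conditional mean is a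
supermartingale, hence almost surely bounded. -/
theorem IsChain.ae_bddAbove (hX : IsChain μ X T θ) [IsProbabilityMeasure μ] (hm : 0 < m)
    {L : ℕ → (ℕ → Fin m) → ℝ} (hnn : ∀ n x, 0 ≤ L n x)
    (hdep : ∀ n x y, (∀ k < D + n, x k = y k) → L n x = L n y)
    (hstep : ∀ n x, ∑ a, stepProb T θ (window D x n) a *
      L (n + 1) (Function.update x (D + n) a) ≤ L n x) :
    ∀ᵐ ω ∂μ, ∃ C, ∀ n, L n (fun k => X k ω) ≤ C := by
  have hint : ∀ n, Integrable (fun ω => L n fun k => X k ω) μ :=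
    fun n => hX.integrable_of_dependsOn hm (hdep n)
  have hsuper : Supermartingale (fun n ω => L n fun k => X k ω) hX.filtration μ := by
    refine supermartingale_of_setIntegral_succ_le
      (fun n => (hX.measurable_of_dependsOn hm (hdep n)).stronglyMeasurable) hint ?_
    rintro n s ⟨A, -, rfl⟩
    have hU : (fun ω (k : Fin (D + n)) => X k ω) ⁻¹' A =
        ⋃ f ∈ A.toFinite.toFinset, cylinder X (D + n) (extend hm f) := by
      ext ω
      simp [mem_cylinder_extend_iff]
    have hdisj : Set.Pairwise (A.toFinite.toFinset : Set (Fin (D + n) → Fin m))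
        (Function.onFun Disjoint fun f => cylinder X (D + n) (extend hm f)) := by
      intro f _ g _ hfg
      rw [Function.onFun, Set.disjoint_left]
      intro ω h1 h2
      rw [mem_cylinder_extend_iff] at h1 h2
      exact hfg (h1.symm.trans h2)
    rw [hU, integral_biUnion_finset _ (fun f _ => hX.measurableSet_cylinder _ _) hdisj
      (fun f _ => (hint _).integrableOn), integral_biUnion_finset _
      (fun f _ => hX.measurableSet_cylinder _ _) hdisj (fun f _ => (hint _).integrableOn)]
    exact Finset.sum_le_sum fun f _ => hX.setIntegral_cylinder_succ_le hdep hstep hint n _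
  have hmean : ∀ n, ∫ ω, L n (fun k => X k ω) ∂μ ≤ ∫ ω, L 0 (fun k => X k ω) ∂μ := by
    intro n
    have := hsuper.setIntegral_le (Nat.zero_le n) MeasurableSet.univ
    simpa using this
  have hbdd : ∀ n, eLpNorm ((-fun n ω => L n fun k => X k ω) n) 1 μ ≤
      (Real.toNNReal (∫ ω, L 0 (fun k => X k ω) ∂μ) : NNReal) := by
    intro n
    rw [Pi.neg_apply, eLpNorm_neg, eLpNorm_one_eq_lintegral_enorm,
      ← ofReal_integral_norm_eq_lintegral_enorm (hint n)]
    refine ENNReal.ofReal_le_ofReal ?_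
    simp_rw [Real.norm_eq_abs, abs_of_nonneg (hnn _ _)]
    exact hmean n
  filter_upwards [hsuper.neg.exists_ae_tendsto_of_bdd hbdd] with ω ⟨c, hc⟩
  have hc' := hc.neg
  simp only [Pi.neg_apply, neg_neg] at hc'
  obtain ⟨C, hC⟩ := hc'.bddAbove_range
  exact ⟨C, fun n => hC ⟨n, rfl⟩⟩

/-- Transitions of probability zero do not occur. -/
theorem IsChain.ae_stepProb_ne_zero (hX : IsChain μ X T θ) [IsProbabilityMeasure μ]
    (hm : 0 < m) :
    ∀ᵐ ω ∂μ, ∀ n, stepProb T θ (window D (fun k => X k ω) n) (X (D + n) ω) ≠ 0 := by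
  rw [ae_all_iff]
  intro n
  have h0 : ∀ f : Fin (D + n + 1) → Fin m,
      stepProb T θ (window D (extend hm f) n) (extend hm f (D + n)) = 0 →
        μ (cylinder X (D + n + 1) (extend hm f)) = 0 := by
    intro f hf
    have h := hX.step n (extend hm f)
    rw [hf, mul_zero] at h
    exact (measureReal_eq_zero_iff (measure_ne_top _ _)).1 h
  rw [ae_iff]
  refine measure_mono_null (t := ⋃ f : {f : Fin (D + n + 1) → Fin m //
    stepProb T θ (window D (extend hm f) n) (extend hm f (D + n)) = 0},
      cylinder X (D + n + 1) (extend hm f.1)) ?_ (measure_iUnion_null fun f => h0 f.1 f.2)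
  intro ω hω
  simp only [not_not, Set.mem_ofPred_eq] at hω
  have hext : ∀ k < D + (n + 1), extend hm (fun k : Fin (D + n + 1) => X k ω) k = X k ω := by
    intro k hk
    simp only [extend, show k < D + n + 1 from hk, dif_pos]
  refine Set.mem_iUnion.2 ⟨⟨fun k => X k ω, ?_⟩, (mem_cylinder_extend_iff hm _ ω).2 rfl⟩
  rw [window_congr hext (Nat.le_succ n), hext _ (by omega)]
  exact hω

/-! ### Deviations of additive functionals -/

/-- The additive functional `∑ i < n, g (Z_i, X_{i+1})`. -/
def addFun (D : ℕ) (g : (Fin D → Fin m) → Fin m → ℝ) (n : ℕ) (x : ℕ → Fin m) : ℝ :=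
  ∑ i ∈ Finset.range n, g (window D x i) (x (D + i))

theorem addFun_congr (g : (Fin D → Fin m) → Fin m → ℝ) {n : ℕ} {x y : ℕ → Fin m}
    (h : ∀ k < D + n, x k = y k) : addFun D g n x = addFun D g n y := by
  refine Finset.sum_congr rfl fun i hi => ?_
  have := Finset.mem_range.1 hi
  rw [window_congr h (by omega), h _ (by omega)]

theorem addFun_update (g : (Fin D → Fin m) → Fin m → ℝ) (n : ℕ) (x : ℕ → Fin m) (a : Fin m) :
    addFun D g (n + 1) (Function.update x (D + n) a) = addFun D g n x + g (window D x n) a := by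
  have h : ∀ k < D + n, Function.update x (D + n) a k = x k :=
    fun k hk => Function.update_of_ne (by omega) _ _
  rw [← addFun_congr g h, addFun, Finset.sum_range_succ, Function.update_self,
    window_congr h le_rfl]
  rfl

theorem abs_addFun_le {g : (Fin D → Fin m) → Fin m → ℝ} (hg : ∀ z a, |g z a| ≤ 1) (n : ℕ)
    (x : ℕ → Fin m) : |addFun D g n x| ≤ n := by
  refine (Finset.abs_sum_le_sum_abs _ _).trans ?_
  calc _ ≤ ∑ _i ∈ Finset.range n, (1 : ℝ) := Finset.sum_le_sum fun i _ => hg _ _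
    _ = n := by simp

theorem sum_mul_exp_le {p g : Fin m → ℝ} (hp : ∀ a, 0 ≤ p a) (hp1 : ∑ a, p a = 1)
    (hg : ∀ a, |g a| ≤ 1) (h0 : ∑ a, p a * g a = 0) {t : ℝ} (ht : |t| ≤ 1) :
    ∑ a, p a * Real.exp (t * g a) ≤ Real.exp (t ^ 2) := by
  have h : ∀ a, p a * Real.exp (t * g a) ≤ p a * (1 + t ^ 2) + t * (p a * g a) := by
    intro a
    have h1 : |t * g a| ≤ 1 := by
      rw [abs_mul]; exact mul_le_one₀ ht (abs_nonneg _) (hg a)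
    have h2 := (abs_le.1 (Real.abs_exp_sub_one_sub_id_le h1)).2
    have h3 : (t * g a) ^ 2 ≤ t ^ 2 := by
      rw [mul_pow]
      exact mul_le_of_le_one_right (sq_nonneg t) ((sq_le_one_iff_abs_le_one _).2 (hg a))
    nlinarith [mul_le_mul_of_nonneg_left (show Real.exp (t * g a) ≤ 1 + t ^ 2 + t * g a by
      linarith) (hp a)]
  calc _ ≤ ∑ a, (p a * (1 + t ^ 2) + t * (p a * g a)) := Finset.sum_le_sum fun a _ => h a
    _ = 1 + t ^ 2 := by
      rw [Finset.sum_add_distrib, ← Finset.sum_mul, ← Finset.mul_sum, hp1, h0]; ring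
    _ ≤ _ := by linarith [Real.add_one_le_exp (t ^ 2)]

/-- Method of mixtures: the exponential supermartingales with parameters `2⁻ᵏ` are mixed with
weights `(k + 1)⁻²`, and the mixture is almost surely bounded. The slow decay of the
weights is what yields a bound of iterated-logarithm type. -/
theorem IsChain.ae_mixture_bound (hX : IsChain μ X T θ) [IsProbabilityMeasure μ] (hm : 0 < m)
    (hθ : T.IsParam θ) {g : (Fin D → Fin m) → Fin m → ℝ} (hg : ∀ z a, |g z a| ≤ 1)
    (h0 : ∀ z, ∑ a, stepProb T θ z a * g z a = 0) :
    ∀ᵐ ω ∂μ, ∃ C, ∀ n k : ℕ, (1 / 2 : ℝ) ^ k * addFun D g n (fun i => X i ω) -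
      ((1 / 2 : ℝ) ^ k) ^ 2 * n ≤ C + 2 * Real.log (k + 1) := by
  set w : ℕ → ℝ := fun k => 1 / ((k : ℝ) + 1) ^ 2 with hw
  have hw0 : ∀ k, 0 < w k := fun k => by positivity
  have hws : Summable w := by
    have := (summable_nat_add_iff 1).2 (Real.summable_one_div_nat_pow.2 (by norm_num : 1 < 2))
    simpa [hw] using this
  have ht : ∀ k : ℕ, |(1 / 2 : ℝ) ^ k| ≤ 1 := fun k => by
    rw [abs_of_pos (by positivity)]
    exact pow_le_one₀ (by norm_num) (by norm_num)
  set e : ℕ → ℕ → (ℕ → Fin m) → ℝ := fun k n x =>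
    w k * Real.exp ((1 / 2 : ℝ) ^ k * addFun D g n x - ((1 / 2 : ℝ) ^ k) ^ 2 * n) with he
  have he0 : ∀ k n x, 0 ≤ e k n x := fun k n x => mul_nonneg (hw0 k).le (Real.exp_pos _).le
  have hes : ∀ n x, Summable fun k => e k n x := by
    intro n x
    refine Summable.of_nonneg_of_le (fun k => he0 k n x) (fun k => ?_)
      (hws.mul_right (Real.exp n))
    refine mul_le_mul_of_nonneg_left (Real.exp_le_exp.2 ?_) (hw0 k).le
    have h1 : (1 / 2 : ℝ) ^ k * addFun D g n x ≤ n := by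
      refine (le_abs_self _).trans ?_
      rw [abs_mul, ← one_mul (n : ℝ)]
      exact mul_le_mul (ht k) (abs_addFun_le hg n x) (abs_nonneg _) zero_le_one
    have h2 : 0 ≤ ((1 / 2 : ℝ) ^ k) ^ 2 * n := by positivity
    linarith
  have hstep : ∀ k n x, ∑ a, stepProb T θ (window D x n) a *
      e k (n + 1) (Function.update x (D + n) a) ≤ e k n x := by
    intro k n x
    set t := (1 / 2 : ℝ) ^ k with htdef
    have h1 : ∀ a, stepProb T θ (window D x n) a * e k (n + 1) (Function.update x (D + n) a) =
        e k n x * Real.exp (-t ^ 2) *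
          (stepProb T θ (window D x n) a * Real.exp (t * g (window D x n) a)) := by
      intro a
      simp only [he, addFun_update, ← htdef]
      rw [show t * (addFun D g n x + g (window D x n) a) - t ^ 2 * ((n + 1 : ℕ) : ℝ) =
        (t * addFun D g n x - t ^ 2 * n) + -t ^ 2 + t * g (window D x n) a by push_cast; ring,
        Real.exp_add, Real.exp_add]
      ring
    simp_rw [h1]
    rw [← Finset.mul_sum]
    have h2 := sum_mul_exp_le (stepProb_nonneg hθ (window D x n)) (sum_stepProb hθ _)
      (hg (window D x n)) (h0 _) (ht k)
    calc _ ≤ e k n x * Real.exp (-t ^ 2) * Real.exp (t ^ 2) :=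
          mul_le_mul_of_nonneg_left h2 (mul_nonneg (he0 k n x) (Real.exp_pos _).le)
      _ = e k n x := by rw [mul_assoc, ← Real.exp_add]; simp
  have hb := hX.ae_bddAbove hm (L := fun n x => ∑' k, e k n x)
    (fun n x => tsum_nonneg fun k => he0 k n x)
    (fun n x y h => by simp only [he, addFun_congr g h])
    (fun n x => by
      simp_rw [← tsum_mul_left]
      rw [← Summable.tsum_finsetSum fun a _ => (hes _ _).mul_left _]
      exact Summable.tsum_le_tsum (fun k => hstep k n x)
        (summable_sum fun a _ => (hes _ _).mul_left _) (hes n x))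
  filter_upwards [hb] with ω ⟨C, hC⟩
  refine ⟨Real.log C, fun n k => ?_⟩
  have h1 : e k n (fun i => X i ω) ≤ C :=
    ((hes n _).le_tsum k fun j _ => he0 j n _).trans (hC n)
  have h2 : 0 < e k n (fun i => X i ω) := mul_pos (hw0 k) (Real.exp_pos _)
  have h3 := Real.log_le_log h2 h1
  have h4 : Real.log (w k) = -(2 * Real.log (k + 1)) := by simp [hw]
  rw [he, Real.log_mul (hw0 k).ne' (Real.exp_pos _).ne', Real.log_exp, h4] at h3
  linarith

open Asymptotics in
theorem isLittleO_sq_add_log (C : ℝ) :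
    (fun y : ℝ => (C + 2 * Real.log (y + 1)) ^ 2) =o[atTop] fun y => y := by
  have h1 : (fun y : ℝ => C + 2 * Real.log (y + 1)) =o[atTop] fun y => (y + 1) ^ (1 / 2 : ℝ) := by
    have hshift : Tendsto (fun y : ℝ => y + 1) atTop atTop :=
      tendsto_atTop_add_const_right _ _ tendsto_id
    have h2 : (fun y : ℝ => C + 2 * Real.log y) =o[atTop] fun y => y ^ (1 / 2 : ℝ) := by
      refine IsLittleO.add ?_ ((isLittleO_log_rpow_atTop (by norm_num)).const_mul_left 2)
      exact (isLittleO_const_left.2 (Or.inr (tendsto_norm_atTop_atTop.comp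
        (tendsto_rpow_atTop (by norm_num)))))
    exact h2.comp_tendsto hshift
  have h3 := h1.pow (n := 2) (by norm_num)
  refine h3.trans_isBigO ?_
  refine IsBigO.of_bound 2 ?_
  filter_upwards [eventually_ge_atTop 1] with y hy
  rw [← Real.rpow_natCast, ← Real.rpow_mul (by linarith), Real.norm_eq_abs, Real.norm_eq_abs,
    abs_of_nonneg (by positivity), abs_of_nonneg (by linarith)]
  norm_num
  linarith

/-- Centred additive functionals `M` of the chain satisfy `M_n² = o(n log n)` almost surely. -/
theorem IsChain.ae_sq_addFun_isLittleO (hX : IsChain μ X T θ) [IsProbabilityMeasure μ]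
    (hm : 0 < m) (hθ : T.IsParam θ) {g : (Fin D → Fin m) → Fin m → ℝ} (hg : ∀ z a, |g z a| ≤ 1)
    (h0 : ∀ z, ∑ a, stepProb T θ z a * g z a = 0) :
    ∀ᵐ ω ∂μ, (fun n : ℕ => addFun D g n (fun i => X i ω) ^ 2 / n) =o[atTop]
      fun n : ℕ => Real.log n := by
  have hneg := hX.ae_mixture_bound hm hθ (g := fun z a => -g z a) (fun z a => by
    rw [abs_neg]; exact hg z a) (fun z => by simp [h0 z])
  filter_upwards [hX.ae_mixture_bound hm hθ hg h0, hneg] with ω ⟨C₁, hC₁⟩ ⟨C₂, hC₂⟩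
  set M : ℕ → ℝ := fun n => addFun D g n (fun i => X i ω) with hM
  have hMneg : ∀ n, addFun D (fun z a => -g z a) n (fun i => X i ω) = -M n := fun n => by
    simp [hM, addFun]
  set C := max (|C₁|) (|C₂|) with hC
  have hlog := (isLittleO_sq_add_log (2 + C)).comp_tendsto
    (Real.tendsto_log_atTop.comp tendsto_natCast_atTop_atTop)
  refine Asymptotics.IsBigO.trans_isLittleO ?_ hlog
  refine Asymptotics.IsBigO.of_bound 1 ?_
  filter_upwards [eventually_ge_atTop 1] with n hn
  -- The mixture bound is used with `4 ^ k ≤ n < 4 ^ (k + 1)`, so that `2⁻ᵏ` is about `1 / √n`.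
  set k := Nat.log 4 n with hk
  have hn0 : (0 : ℝ) < n := by exact_mod_cast hn
  have hk1 : (4 : ℝ) ^ k ≤ n := by exact_mod_cast Nat.pow_log_le_self 4 (by omega)
  have hk2 : (n : ℝ) ≤ 4 ^ k * 4 := by
    have := (Nat.lt_pow_succ_log_self (by norm_num : 1 < 4) n).le
    rw [pow_succ] at this
    exact_mod_cast this
  have hk3 : (k : ℝ) ≤ Real.log n := by
    have h1 := Real.log_le_log (by positivity) hk1
    rw [Real.log_pow] at h1
    have h2 : 1 ≤ Real.log 4 := by
      rw [show (4 : ℝ) = 2 ^ 2 by norm_num, Real.log_pow]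
      have := Real.log_two_gt_d9
      push_cast
      linarith
    nlinarith [(Nat.cast_nonneg k : (0 : ℝ) ≤ k)]
  have hlk : Real.log (k + 1) ≤ Real.log (Real.log n + 1) :=
    Real.log_le_log (by positivity) (by linarith)
  have hlk0 : 0 ≤ Real.log ((k : ℝ) + 1) :=
    Real.log_nonneg (by linarith [(Nat.cast_nonneg k : (0 : ℝ) ≤ k)])
  set s : ℝ := √n with hs
  have hs0 : 0 < s := Real.sqrt_pos.2 hn0
  have hss : s ^ 2 = n := Real.sq_sqrt hn0.le
  have h4 : (4 : ℝ) ^ k = (2 ^ k) ^ 2 := by rw [← pow_mul, mul_comm, pow_mul]; norm_num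
  have h2k : (0 : ℝ) < 2 ^ k := by positivity
  have hk4 : (2 : ℝ) ^ k ≤ s := by
    refine (sq_le_sq₀ h2k.le hs0.le).1 ?_
    rw [hss, ← h4]; exact hk1
  have hk5 : s ≤ 2 * 2 ^ k := by
    refine (sq_le_sq₀ hs0.le (by positivity)).1 ?_
    rw [hss, mul_pow, ← h4]; linarith
  have haux : ∀ y c : ℝ, |c| ≤ C →
      (1 / 2 : ℝ) ^ k * y - ((1 / 2 : ℝ) ^ k) ^ 2 * n ≤ c + 2 * Real.log (k + 1) →
        y ≤ s * (2 + C + 2 * Real.log (Real.log n + 1)) := by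
    intro y c hc h
    have hcle : c ≤ C := (le_abs_self c).trans hc
    have hC0 : 0 ≤ C := (abs_nonneg c).trans hc
    have h1 := mul_le_mul_of_nonneg_left h h2k.le
    have h2 : (2 : ℝ) ^ k * (1 / 2) ^ k = 1 := by rw [← mul_pow]; norm_num
    have h3 : (2 : ℝ) ^ k * ((1 / 2 : ℝ) ^ k * y - ((1 / 2 : ℝ) ^ k) ^ 2 * n) =
        y - (1 / 2 : ℝ) ^ k * n := by
      linear_combination (y - (1 / 2 : ℝ) ^ k * n) * h2
    rw [h3] at h1
    have h5 : (1 / 2 : ℝ) ^ k * n ≤ 2 * s := by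
      rw [← hss]
      have : (1 / 2 : ℝ) ^ k * s ≤ 2 := by
        calc (1 / 2 : ℝ) ^ k * s ≤ (1 / 2 : ℝ) ^ k * (2 * 2 ^ k) := by gcongr
          _ = 2 := by linear_combination 2 * h2
      nlinarith
    have h6 : (2 : ℝ) ^ k * (c + 2 * Real.log (k + 1)) ≤
        s * (C + 2 * Real.log (Real.log n + 1)) := by
      calc (2 : ℝ) ^ k * (c + 2 * Real.log (k + 1))
          ≤ (2 : ℝ) ^ k * (C + 2 * Real.log (Real.log n + 1)) := by gcongr
        _ ≤ _ := by
          refine mul_le_mul_of_nonneg_right hk4 ?_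
          linarith
    nlinarith
  have hup := haux (M n) C₁ (le_max_left _ _) (hC₁ n k)
  have hlow := haux (-M n) C₂ (le_max_right _ _) (by rw [← hMneg]; exact hC₂ n k)
  have habs : |M n| ≤ s * (2 + C + 2 * Real.log (Real.log n + 1)) := abs_le.2 ⟨by linarith, hup⟩
  simp only [Function.comp_apply, one_mul]
  rw [Real.norm_of_nonneg (by positivity), Real.norm_of_nonneg (by positivity), div_le_iff₀ hn0]
  calc M n ^ 2 = |M n| ^ 2 := (sq_abs _).symm
    _ ≤ (s * (2 + C + 2 * Real.log (Real.log n + 1))) ^ 2 := by gcongr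
    _ = _ := by rw [mul_pow, hss]; ring

end Chain

/-! ### Typical sequences -/

section Typical

variable {m D : ℕ}

/-- The number of occurrences of the block `z` (followed by some symbol of the sample). -/
def visits (D : ℕ) (x : ℕ → Fin m) (n : ℕ) (z : Fin D → Fin m) : ℕ := ∑ j, blockCount D x n z j

theorem visits_eq_card (x : ℕ → Fin m) (n : ℕ) (z : Fin D → Fin m) :
    visits D x n z = ((Finset.range n).filter fun i => window D x i = z).card := by
  rw [visits, Finset.card_eq_sum_card_fiberwise (f := fun i => x (D + i)) (t := Finset.univ)
    (fun i _ => Finset.mem_coe.2 (Finset.mem_univ _))]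
  refine Finset.sum_congr rfl fun j _ => ?_
  rw [blockCount, Finset.filter_filter]

theorem sum_visits (x : ℕ → Fin m) (n : ℕ) : ∑ z : Fin D → Fin m, visits D x n z = n := by
  simp_rw [visits_eq_card]
  rw [← Finset.card_eq_sum_card_fiberwise (fun i _ => Finset.mem_coe.2 (Finset.mem_univ _)),
    Finset.card_range]

/-- A sequence is typical for the chain with model `T` and parameters `θ` if all its transitions
have positive probability and the empirical transition counts satisfy a weak form of the law of
the iterated logarithm. -/
structure Typical (T : Model m D) (θ : T.Params) (x : ℕ → Fin m) : Prop where
  zero : ∀ n z j, stepProb T θ z j = 0 → blockCount D x n z j = 0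
  dev : ∀ z j, (fun n : ℕ => ((blockCount D x n z j : ℝ) -
    stepProb T θ z j * visits D x n z) ^ 2 / n) =o[atTop] fun n : ℕ => Real.log n

theorem IsChain.ae_typical {Ω : Type*} [MeasurableSpace Ω] {μ : Measure Ω} {X : ℕ → Ω → Fin m}
    {T : Model m D} {θ : T.Params} (hX : IsChain μ X T θ) [IsProbabilityMeasure μ] (hm : 0 < m)
    (hθ : T.IsParam θ) : ∀ᵐ ω ∂μ, Typical T θ fun k => X k ω := by
  have hdev : ∀ z j, ∀ᵐ ω ∂μ, (fun n : ℕ => ((blockCount D (fun k => X k ω) n z j : ℝ) -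
      stepProb T θ z j * visits D (fun k => X k ω) n z) ^ 2 / n) =o[atTop]
        fun n : ℕ => Real.log n := by
    intro z j
    -- The additive functional of this centred `g` is `blockCount - stepProb * visits`.
    set g : (Fin D → Fin m) → Fin m → ℝ := fun w a =>
      if w = z then (if a = j then 1 else 0) - stepProb T θ z j else 0 with hg
    have h0 := stepProb_nonneg hθ z j
    have h1 := stepProb_le_one hθ z j
    have hg1 : ∀ w a, |g w a| ≤ 1 := by
      intro w a
      simp only [hg]
      split_ifs <;> simp [abs_le] <;> constructor <;> linarith
    have hg0 : ∀ w, ∑ a, stepProb T θ w a * g w a = 0 := by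
      intro w
      by_cases hw : w = z
      · subst hw
        simp [hg, mul_sub, Finset.sum_sub_distrib, ← Finset.sum_mul, sum_stepProb hθ w]
      · simp [hg, hw]
    filter_upwards [hX.ae_sq_addFun_isLittleO hm hθ hg1 hg0] with ω hω
    convert hω using 4 with n
    rw [visits_eq_card, blockCount, addFun, Finset.card_filter, Finset.card_filter, Nat.cast_sum,
      Nat.cast_sum, Finset.mul_sum, ← Finset.sum_sub_distrib]
    refine Finset.sum_congr rfl fun i _ => ?_
    simp only [hg]
    by_cases h1 : window D (fun k => X k ω) i = z <;> by_cases h2 : X (D + i) ω = j <;>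
      simp [h1, h2]
  filter_upwards [hX.ae_stepProb_ne_zero hm, ae_all_iff.2 fun z => ae_all_iff.2 fun j => hdev z j]
    with ω h1 h2
  refine ⟨fun n z j hz => ?_, h2⟩
  rw [blockCount, Finset.card_eq_zero, Finset.filter_eq_empty_iff]
  rintro i _ ⟨h3, h4⟩
  exact h1 i (by rw [h3, h4]; exact hz)

variable {T : Model m D} {θ : T.Params} {x : ℕ → Fin m}

theorem Typical.eventually_abs_le (h : Typical T θ x) (z : Fin D → Fin m) (j : Fin m) {ε : ℝ}
    (hε : 0 < ε) : ∀ᶠ n : ℕ in atTop,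
      |(blockCount D x n z j : ℝ) - stepProb T θ z j * visits D x n z| ≤ ε * n := by
  filter_upwards [(h.dev z j).bound (show 0 < ε ^ 2 by positivity), eventually_ge_atTop 1]
    with n hn hn1
  have hn0 : (1 : ℝ) ≤ n := by exact_mod_cast hn1
  have hlog : Real.log n ≤ n := (Real.log_le_sub_one_of_pos (by linarith)).trans (by linarith)
  rw [Real.norm_of_nonneg (by positivity), Real.norm_of_nonneg (Real.log_nonneg hn0),
    div_le_iff₀ (by linarith)] at hn
  refine abs_le_of_sq_le_sq ?_ (by positivity)
  calc _ ≤ ε ^ 2 * Real.log n * n := hn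
    _ ≤ ε ^ 2 * n * n := by gcongr
    _ = _ := by ring

theorem window_succ (x : ℕ → Fin m) (i : ℕ) :
    window D x (i + 1) = shift (window D x i) (x (D + i)) := by
  have h : (Fin.snoc (window D x i) (x (D + i)) : Fin (D + 1) → Fin m) =
      fun k : Fin (D + 1) => x (i + (k : ℕ)) := by
    funext k
    induction k using Fin.lastCases with
    | last => simp [add_comm]
    | cast k => simp [window]
  rw [shift, h]
  funext k
  simp only [window, Fin.tail, Fin.val_succ]
  congr 1
  omega

/-- Each occurrence of `z` followed by `a` is followed by one of `shift z a`, except possibly at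
the end of the sample. -/
theorem blockCount_le_visits_shift (x : ℕ → Fin m) (n : ℕ) (z : Fin D → Fin m) (a : Fin m) :
    blockCount D x n z a ≤ visits D x n (shift z a) + 1 := by
  have h1 : blockCount D x n z a ≤ visits D x (n + 1) (shift z a) := by
    rw [visits_eq_card, blockCount, ← Finset.card_image_of_injective _ (add_left_injective 1)]
    refine Finset.card_le_card fun i hi => ?_
    obtain ⟨k, hk, rfl⟩ := Finset.mem_image.1 hi
    rw [Finset.mem_filter, Finset.mem_range] at hk ⊢
    exact ⟨by omega, by rw [window_succ, hk.2.1, hk.2.2]⟩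
  refine h1.trans ?_
  rw [visits_eq_card, visits_eq_card, Finset.range_add_one, Finset.filter_insert]
  split_ifs
  · exact Finset.card_insert_le _ _
  · omega

theorem transMatrix_nonneg (hθ : T.IsParam θ) (z z' : Fin D → Fin m) :
    0 ≤ transMatrix T θ z z' := by
  rw [transMatrix, Matrix.of_apply]
  refine Finset.sum_nonneg fun a _ => ?_
  split_ifs
  exacts [stepProb_nonneg hθ z a, le_rfl]

/-- Visits propagate along transitions of positive probability. -/
theorem Typical.visits_of_pow_pos (h : Typical T θ x) (hθ : T.IsParam θ) (z : Fin D → Fin m)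
    (k : ℕ) : ∀ z', 0 < (transMatrix T θ ^ k) z z' → ∃ c > 0, ∀ ε > 0, ∀ᶠ n : ℕ in atTop,
      c * (visits D x n z : ℝ) - ε * n ≤ visits D x n z' := by
  induction k with
  | zero =>
    intro z' hz'
    rw [pow_zero, Matrix.one_apply] at hz'
    have : z = z' := by
      by_contra hne
      simp [hne] at hz'
    subst this
    refine ⟨1, one_pos, fun ε hε => Eventually.of_forall fun n => ?_⟩
    have : 0 ≤ ε * n := by positivity
    linarith
  | succ k ih =>
    intro z' hz'
    rw [pow_succ, Matrix.mul_apply] at hz'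
    obtain ⟨w, -, hw⟩ := Finset.exists_lt_of_sum_lt (f := fun _ => (0 : ℝ)) (by simpa using hz')
    have hw2 : 0 < transMatrix T θ w z' := by
      refine (transMatrix_nonneg hθ w z').lt_of_ne fun h0 => ?_
      rw [← h0, mul_zero] at hw
      exact lt_irrefl _ hw
    have hw1 : 0 < (transMatrix T θ ^ k) z w := (pos_iff_pos_of_mul_pos hw).2 hw2
    obtain ⟨c, hc, hcw⟩ := ih w hw1
    rw [transMatrix, Matrix.of_apply] at hw2
    obtain ⟨a, -, ha⟩ := Finset.exists_lt_of_sum_lt (f := fun _ => (0 : ℝ)) (by simpa using hw2)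
    have haz : shift w a = z' := by
      by_contra hne
      simp [hne] at ha
    rw [if_pos haz] at ha
    set p := stepProb T θ w a with hp
    have hp1 : p ≤ 1 := stepProb_le_one hθ w a
    refine ⟨p * c, mul_pos ha hc, fun ε hε => ?_⟩
    have hlarge : ∀ᶠ n : ℕ in atTop, 3 / ε ≤ n :=
      tendsto_natCast_atTop_atTop.eventually_ge_atTop _
    filter_upwards [hcw (ε / 3) (by positivity), h.eventually_abs_le w a
      (show 0 < ε / 3 by positivity), hlarge] with n h1 h2 h3
    have h4 : (blockCount D x n w a : ℝ) ≤ visits D x n z' + 1 := by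
      rw [← haz]; exact_mod_cast blockCount_le_visits_shift x n w a
    have h5 := (abs_le.1 h2).1
    have h6 : 3 ≤ n * ε := (div_le_iff₀ hε).1 h3
    have h7 := mul_le_mul_of_nonneg_left h1 ha.le
    have h8 : p * (ε / 3 * n) ≤ ε / 3 * n := mul_le_of_le_one_left (by positivity) hp1
    nlinarith

/-- By irreducibility, every block has positive lower frequency in a typical sequence. -/
theorem Typical.exists_visits_ge (h : Typical T θ x) (hθ : T.IsParam θ)
    (hirr : (transMatrix T θ).IsIrreducible) :
    ∃ c > 0, ∀ᶠ n : ℕ in atTop, ∀ z, c * (n : ℝ) ≤ visits D x n z := by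
  suffices hz : ∀ z : Fin D → Fin m, ∃ c > 0, ∀ᶠ n : ℕ in atTop,
      c * (n : ℝ) ≤ visits D x n z by
    choose c hc hcz using hz
    have : Nonempty (Fin D → Fin m) := ⟨window D x 0⟩
    obtain ⟨z₀, hz₀⟩ := Finite.exists_min c
    refine ⟨c z₀, hc z₀, ?_⟩
    filter_upwards [eventually_all.2 hcz] with n hn z
    exact (mul_le_mul_of_nonneg_right (hz₀ z) (Nat.cast_nonneg n)).trans (hn z)
  intro z
  have hpow := (Matrix.isIrreducible_iff_exists_pow_pos (transMatrix_nonneg hθ)).1 hirr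
  have hz : ∀ w, ∃ c > 0, ∀ ε > 0, ∀ᶠ n : ℕ in atTop,
      c * (visits D x n w : ℝ) - ε * n ≤ visits D x n z := by
    intro w
    obtain ⟨k, -, hk⟩ := hpow w z
    exact h.visits_of_pow_pos hθ w k z hk
  choose c hc hcw using hz
  set S := ∑ w, (c w)⁻¹ with hS
  have hS0 : 0 < S := Finset.sum_pos (fun w _ => inv_pos.2 (hc w)) ⟨z, Finset.mem_univ z⟩
  -- The visits to all blocks `w` add up to `n`; the errors `n / (2 * S)`, weighted by
  -- `1 / c w`, use up half of this total.
  refine ⟨1 / (2 * S), by positivity, ?_⟩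
  filter_upwards [eventually_all.2 fun w => hcw w (1 / (2 * S)) (by positivity)] with n hn
  have h1 : ∀ w, (visits D x n w : ℝ) ≤
      (c w)⁻¹ * (visits D x n z + 1 / (2 * S) * n) := fun w => by
    rw [← div_eq_inv_mul, le_div_iff₀ (hc w)]
    linarith [hn w]
  have h2 := Finset.sum_le_sum fun w (_ : w ∈ Finset.univ) => h1 w
  rw [← Finset.sum_mul, ← hS, ← Nat.cast_sum, sum_visits] at h2
  have h3 : S * (1 / (2 * S) * n) = n / 2 := by field_simp
  rw [div_mul_eq_mul_div, one_mul, div_le_iff₀ (by positivity)]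
  nlinarith

/-! ### Likelihoods along typical sequences -/

/-- The total count of the letter `j` after the blocks in `Z`. -/
def pooledCount (D : ℕ) (x : ℕ → Fin m) (n : ℕ) (Z : Finset (Fin D → Fin m)) (j : Fin m) : ℕ :=
  ∑ z ∈ Z, blockCount D x n z j

theorem sum_pooledCount (n : ℕ) (Z : Finset (Fin D → Fin m)) :
    ∑ j, pooledCount D x n Z j = ∑ z ∈ Z, visits D x n z := by
  simp only [pooledCount, visits]
  exact Finset.sum_comm

theorem sum_pooledCount_le (n : ℕ) (Z : Finset (Fin D → Fin m)) :
    ∑ j, pooledCount D x n Z j ≤ n := by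
  rw [sum_pooledCount]
  exact (Finset.sum_le_sum_of_subset (Finset.subset_univ Z)).trans (sum_visits x n).le

/-- The log-likelihood, under the chain, of the transitions out of the block `z`. -/
noncomputable def blockLogLik (T : Model m D) (θ : T.Params) (x : ℕ → Fin m) (n : ℕ)
    (z : Fin D → Fin m) : ℝ := ∑ j, (blockCount D x n z j : ℝ) * Real.log (stepProb T θ z j)

theorem sum_pooledCount_mul_log {Z : Finset (Fin D → Fin m)} {q : Fin m → ℝ}
    (hq : ∀ z ∈ Z, ∀ j, stepProb T θ z j = q j) (n : ℕ) :
    ∑ j, (pooledCount D x n Z j : ℝ) * Real.log (q j) = ∑ z ∈ Z, blockLogLik T θ x n z := by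
  simp only [pooledCount, blockLogLik, Nat.cast_sum, Finset.sum_mul]
  rw [Finset.sum_comm]
  exact Finset.sum_congr rfl fun z hz => Finset.sum_congr rfl fun j _ => by rw [hq z hz j]

theorem Typical.pooledCount_eq_zero (h : Typical T θ x) {Z : Finset (Fin D → Fin m)}
    {q : Fin m → ℝ} (hq : ∀ z ∈ Z, ∀ j, stepProb T θ z j = q j) (n : ℕ) (j : Fin m)
    (hj : q j = 0) : pooledCount D x n Z j = 0 :=
  Finset.sum_eq_zero fun z hz => h.zero n z j ((hq z hz j).trans hj)

/-- Pooling blocks with the same transition probabilities, the true log-likelihood is at most the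
maximal one. -/
theorem Typical.sum_blockLogLik_le (h : Typical T θ x) {Z : Finset (Fin D → Fin m)}
    {q : Fin m → ℝ} (hqs : q ∈ stdSimplex ℝ (Fin m))
    (hq : ∀ z ∈ Z, ∀ j, stepProb T θ z j = q j) (n : ℕ) :
    ∑ z ∈ Z, blockLogLik T θ x n z ≤ logMaxLik (pooledCount D x n Z) := by
  rw [← sum_pooledCount_mul_log hq]
  exact sum_mul_log_le_logMaxLik _ hqs (h.pooledCount_eq_zero hq n)

/-- Pooling blocks with the same transition probabilities, the maximal log-likelihood exceeds the
true one by `o(log n)` only. -/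
theorem Typical.eventually_logMaxLik_le (h : Typical T θ x) (hθ : T.IsParam θ)
    (hirr : (transMatrix T θ).IsIrreducible) {Z : Finset (Fin D → Fin m)} (hZ : Z.Nonempty)
    {q : Fin m → ℝ} (hqs : q ∈ stdSimplex ℝ (Fin m))
    (hq : ∀ z ∈ Z, ∀ j, stepProb T θ z j = q j) {ε : ℝ} (hε : 0 < ε) :
    ∀ᶠ n : ℕ in atTop, logMaxLik (pooledCount D x n Z) ≤
      ∑ z ∈ Z, blockLogLik T θ x n z + ε * Real.log n := by
  obtain ⟨c, hc, hcn⟩ := h.exists_visits_ge hθ hirr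
  obtain ⟨z₀, hz₀⟩ := hZ
  -- `R n` dominates the `χ²` statistic.
  set R : ℕ → ℝ := fun n => ∑ j, ∑ z ∈ Z, (Z.card / (c * q j)) *
    (((blockCount D x n z j : ℝ) - stepProb T θ z j * visits D x n z) ^ 2 / n) with hR
  have hRo : R =o[atTop] fun n : ℕ => Real.log n :=
    Asymptotics.IsLittleO.fun_sum fun j _ => Asymptotics.IsLittleO.fun_sum fun z _ =>
      (h.dev z j).const_mul_left _
  filter_upwards [hcn, hRo.bound hε, eventually_ge_atTop 1] with n h1 h2 hn
  have hn0 : (1 : ℝ) ≤ n := by exact_mod_cast hn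
  set N : ℕ := ∑ j, pooledCount D x n Z j with hN
  have hNv : N = ∑ z ∈ Z, visits D x n z := sum_pooledCount n Z
  have hcN : c * n ≤ N := by
    refine (h1 z₀).trans ?_
    rw [hNv]
    exact_mod_cast Finset.single_le_sum (f := fun z => visits D x n z)
      (fun _ _ => Nat.zero_le _) hz₀
  have hcn0 : 0 < c * n := by positivity
  have hN0 : 0 < N := by
    have : (0 : ℝ) < N := by linarith
    exact_mod_cast this
  refine (logMaxLik_le_add_chiSq _ hqs (h.pooledCount_eq_zero hq n) hN0).trans ?_
  rw [sum_pooledCount_mul_log hq, ← hN]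
  gcongr
  refine le_trans ?_ ((le_abs_self _).trans (h2.trans_eq (by
    rw [Real.norm_of_nonneg (Real.log_nonneg hn0)])))
  refine Finset.sum_le_sum fun j _ => ?_
  rcases (hqs.1 j).eq_or_lt with hj | hj
  · simp [← hj]
  have h3 : (pooledCount D x n Z j : ℝ) - N * q j =
      ∑ z ∈ Z, ((blockCount D x n z j : ℝ) - stepProb T θ z j * visits D x n z) := by
    rw [hNv, pooledCount, Finset.sum_sub_distrib]
    push_cast
    rw [Finset.sum_mul]
    congr 1
    exact Finset.sum_congr rfl fun z hz => by rw [hq z hz j, mul_comm]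
  rw [h3, ← Finset.mul_sum, ← Finset.sum_div, div_mul_div_comm]
  have h5 : c * q j * n ≤ N * q j := by nlinarith
  refine div_le_div₀ ?_ (sq_sum_le_card_mul_sum_sq) (by positivity) h5
  exact mul_nonneg (by positivity) (Finset.sum_nonneg fun z _ => sq_nonneg _)

/-! ### Comparison of models -/

theorem count_eq_pooledCount (n : ℕ) (s : List (Fin m)) :
    count D x n s = pooledCount D x n (Finset.univ.filter fun z => IsContext s z) :=
  funext fun j => count_eq_sum_blockCount x n s j

theorem sum_leaves_sum_context (S : Model m D) (f : (Fin D → Fin m) → ℝ) :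
    ∑ s : S.leaves, ∑ z with IsContext s.1 z, f z = ∑ z, f z := by
  rw [← Finset.sum_fiberwise Finset.univ S.ctx f]
  refine Finset.sum_congr rfl fun s _ => Finset.sum_congr ?_ fun _ _ => rfl
  exact Finset.filter_congr fun z _ => S.isContext_iff z s

theorem log_marginal (hm : 0 < m) (n : ℕ) (S : Model m D) :
    Real.log (marginal x n S) = ∑ s : S.leaves, Real.log (ktProb (count D x n s.1)) := by
  rw [marginal_eq_prod_ktProb hm, Real.log_prod fun s _ => (ktProb_pos hm _).ne']

theorem marginal_pos (hm : 0 < m) (n : ℕ) (S : Model m D) : 0 < marginal x n S := by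
  rw [marginal_eq_prod_ktProb hm]
  exact Finset.prod_pos fun s _ => ktProb_pos hm _

/-- The marginal likelihood of the true model is at least its likelihood at the true parameters
with the penalty `(m - 1) / 2 * log n` for each leaf. -/
theorem Typical.log_marginal_ge (h : Typical T θ x) (hθ : T.IsParam θ) (hm : 0 < m) :
    ∃ C, ∀ n : ℕ, ∑ z, blockLogLik T θ x n z -
      T.leaves.card * (((m : ℝ) - 1) / 2 * Real.log (n + 1)) - C ≤
        Real.log (marginal x n T) := by
  obtain ⟨C, hC⟩ := exists_abs_log_ktProb_sub_le hm
  refine ⟨T.leaves.card * C, fun n => ?_⟩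
  have hm1 : (0 : ℝ) ≤ ((m : ℝ) - 1) / 2 := by
    have : (1 : ℝ) ≤ m := by exact_mod_cast hm
    linarith
  have hs : ∀ s : T.leaves, ∑ z with IsContext s.1 z, blockLogLik T θ x n z -
      ((m : ℝ) - 1) / 2 * Real.log (n + 1) - C ≤ Real.log (ktProb (count D x n s.1)) := by
    intro s
    have h1 := (abs_le.1 (hC (count D x n s.1))).1
    have h2 := h.sum_blockLogLik_le (Z := Finset.univ.filter fun z => IsContext s.1 z) (hθ s)
      (fun z hz j => by
        rw [stepProb_eq, (T.isContext_iff z s).1 (Finset.mem_filter.1 hz).2]) n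
    rw [← count_eq_pooledCount] at h2
    have h3 : Real.log ((∑ j, count D x n s.1 j : ℕ) + 1) ≤ Real.log (n + 1) := by
      refine Real.log_le_log (by positivity) ?_
      have : ∑ j, count D x n s.1 j ≤ n := by
        rw [count_eq_pooledCount]; exact sum_pooledCount_le n _
      exact_mod_cast Nat.succ_le_succ this
    have h4 := mul_le_mul_of_nonneg_left h3 hm1
    linarith
  have := Finset.sum_le_sum fun s (_ : s ∈ Finset.univ) => hs s
  rw [Finset.sum_sub_distrib, Finset.sum_sub_distrib, sum_leaves_sum_context,
    ← log_marginal hm] at this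
  simpa using this

theorem eventually_le_mul_log {a : ℝ} (ha : 0 < a) (b : ℝ) :
    ∀ᶠ n : ℕ in atTop, b ≤ a * Real.log n :=
  ((Real.tendsto_log_atTop.comp tendsto_natCast_atTop_atTop).const_mul_atTop
    ha).eventually_ge_atTop b

theorem log_add_one_le {n : ℕ} (hn : 1 ≤ n) :
    Real.log ((n : ℝ) + 1) ≤ Real.log n + Real.log 2 := by
  have hn0 : (1 : ℝ) ≤ n := by exact_mod_cast hn
  rw [← Real.log_mul (by positivity) (by norm_num)]
  exact Real.log_le_log (by positivity) (by linarith)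

/-- A strict refinement of the true model fits better by `o(log n)` only, and pays a penalty of at
least `1/2 * log n` for each additional leaf. -/
theorem Typical.eventually_log_marginal_lt_of_refines (h : Typical T θ x) (hθ : T.IsParam θ)
    (hirr : (transMatrix T θ).IsIrreducible) (hm : 2 ≤ m) {S : Model m D}
    (hS : S.1.Refines T.1) (hne : S ≠ T) (B : ℝ) :
    ∀ᶠ n : ℕ in atTop, Real.log (marginal x n S) + B ≤ Real.log (marginal x n T) := by
  have hm0 : 0 < m := by omega
  have hcard : T.leaves.card + 1 ≤ S.leaves.card :=
    (hS.eq_or_card_lt hm).resolve_left fun h => hne (Subtype.ext h)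
  obtain ⟨C, hC⟩ := exists_abs_log_ktProb_sub_le hm0
  obtain ⟨C', hC'⟩ := h.log_marginal_ge hθ hm0
  obtain ⟨c, hc, hcn⟩ := h.exists_visits_ge hθ hirr
  set K : ℝ := (S.leaves.card : ℝ) with hK
  set K' : ℝ := (T.leaves.card : ℝ) with hK'
  have hKK : K' + 1 ≤ K := by rw [hK, hK']; exact_mod_cast hcard
  have hK0 : 0 ≤ K' := by positivity
  have hK1 : 0 < K := by linarith
  set r : ℝ := ((m : ℝ) - 1) / 2 with hr
  have hr1 : 1 / 2 ≤ r := by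
    have : (2 : ℝ) ≤ m := by exact_mod_cast hm
    linarith
  -- The accuracy `1 / (4 * K)` per leaf costs `1/4 * log n` in total, half of the least
  -- extra penalty.
  have hU : ∀ s : S.leaves, ∀ᶠ n : ℕ in atTop,
      logMaxLik (pooledCount D x n (Finset.univ.filter fun z => IsContext s.1 z)) ≤
        ∑ z with IsContext s.1 z, blockLogLik T θ x n z + 1 / (4 * K) * Real.log n := by
    intro s
    obtain ⟨t, ht, hts⟩ := hS s.1 s.2
    obtain ⟨z₀, hz₀⟩ := exists_isContext hm0 (S.length_le s.2)
    refine h.eventually_logMaxLik_le hθ hirr ⟨z₀, by simpa using hz₀⟩ (hθ ⟨t, ht⟩)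
      (fun z hz j => ?_) (by positivity)
    rw [stepProb_eq, (T.isContext_iff z ⟨t, ht⟩).1 (hts.trans (Finset.mem_filter.1 hz).2)]
  filter_upwards [eventually_all.2 hU, hcn, eventually_ge_atTop 1,
    eventually_le_mul_log (show (0 : ℝ) < 1 / 4 by norm_num)
      (B + C' + K' * (r * Real.log 2) - K * (r * Real.log c) + K * C)] with n h1 h2 hn h3
  have hn0 : (1 : ℝ) ≤ n := by exact_mod_cast hn
  have hL0 : 0 ≤ Real.log n := Real.log_nonneg hn0
  have hs : ∀ s : S.leaves, Real.log (ktProb (count D x n s.1)) ≤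
      ∑ z with IsContext s.1 z, blockLogLik T θ x n z + 1 / (4 * K) * Real.log n -
        r * (Real.log c + Real.log n) + C := by
    intro s
    have h4 := (abs_le.1 (hC (count D x n s.1))).2
    have h5 := h1 s
    rw [← count_eq_pooledCount] at h5
    obtain ⟨z₀, hz₀⟩ := exists_isContext hm0 (S.length_le s.2)
    have h6 : Real.log c + Real.log n ≤ Real.log ((∑ j, count D x n s.1 j : ℕ) + 1) := by
      rw [← Real.log_mul hc.ne' (by positivity)]
      refine Real.log_le_log (by positivity) ?_
      have h7 : visits D x n z₀ ≤ ∑ j, count D x n s.1 j := by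
        rw [count_eq_pooledCount, sum_pooledCount]
        exact Finset.single_le_sum (f := fun z => visits D x n z) (fun _ _ => Nat.zero_le _)
          (by simpa using hz₀)
      have h8 : (visits D x n z₀ : ℝ) ≤ (∑ j, count D x n s.1 j : ℕ) := by exact_mod_cast h7
      linarith [h2 z₀]
    have h7 := mul_le_mul_of_nonneg_left h6 (show 0 ≤ r by linarith)
    linarith
  have hsum := Finset.sum_le_sum fun s (_ : s ∈ Finset.univ) => hs s
  rw [← log_marginal hm0, Finset.sum_add_distrib, Finset.sum_sub_distrib, Finset.sum_add_distrib,
    sum_leaves_sum_context] at hsum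
  simp only [Finset.sum_const, Finset.card_univ, Fintype.card_coe, nsmul_eq_mul, ← hK] at hsum
  have h9 : K * (1 / (4 * K) * Real.log n) = 1 / 4 * Real.log n := by
    field_simp
  rw [h9] at hsum
  have h10 := hC' n
  have h11 := mul_le_mul_of_nonneg_left (log_add_one_le hn) (show 0 ≤ K' * r by positivity)
  have h12 : 1 / 2 * Real.log n ≤ (K - K') * r * Real.log n := by
    refine mul_le_mul_of_nonneg_right ?_ hL0
    nlinarith
  nlinarith

/-- A model which is not a refinement of the true one merges two contexts with different
transition probabilities, and fits worse by a multiple of `n`. -/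
theorem Typical.eventually_log_marginal_lt_of_not_refines (h : Typical T θ x) (hθ : T.IsParam θ)
    (hmin : T.IsMinimal θ) (hirr : (transMatrix T θ).IsIrreducible) (hm : 2 ≤ m) {S : Model m D}
    (hS : ¬ S.1.Refines T.1) (B : ℝ) :
    ∀ᶠ n : ℕ in atTop, Real.log (marginal x n S) + B ≤ Real.log (marginal x n T) := by
  have hm0 : 0 < m := by omega
  unfold Tree.Refines at hS
  push Not at hS
  obtain ⟨s₀, hs₀, hs₀'⟩ := hS
  obtain ⟨u, hu⟩ := T.1.exists_sibling_leaves_below s₀ (by push Not; exact hs₀')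
  obtain ⟨j, j', hjj⟩ := hmin (s₀ ++ u) hu
  obtain ⟨i, hi⟩ := Function.ne_iff.1 hjj
  obtain ⟨z, hz⟩ := exists_isContext hm0 (T.length_le (hu j))
  obtain ⟨z', hz'⟩ := exists_isContext hm0 (T.length_le (hu j'))
  rw [← (T.isContext_iff z ⟨_, hu j⟩).1 hz, ← (T.isContext_iff z' ⟨_, hu j'⟩).1 hz',
    ← stepProb_eq T θ, ← stepProb_eq T θ] at hi
  have hpre : ∀ k, s₀ <+: s₀ ++ u ++ [k] := fun k => by
    rw [List.append_assoc]; exact List.prefix_append _ _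
  have hsz : IsContext s₀ z := (hpre j).trans hz
  have hsz' : IsContext s₀ z' := (hpre j').trans hz'
  set p := stepProb T θ z i with hp
  set p' := stepProb T θ z' i with hp'
  set δ := |p - p'| with hδ
  have hδ0 : 0 < δ := abs_pos.2 (sub_ne_zero.2 hi)
  obtain ⟨C, hC⟩ := exists_log_ktProb_le hm0
  obtain ⟨C', hC'⟩ := h.log_marginal_ge hθ hm0
  obtain ⟨c, hc, hcn⟩ := h.exists_visits_ge hθ hirr
  set K : ℝ := (S.leaves.card : ℝ) with hK
  set K' : ℝ := (T.leaves.card : ℝ) with hK'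
  set r : ℝ := ((m : ℝ) - 1) / 2 with hr
  set Q : ℝ := (Fintype.card (Fin D → Fin m) : ℝ) with hQ
  have hr0 : 0 ≤ r := by
    have : (2 : ℝ) ≤ m := by exact_mod_cast hm
    linarith
  -- Compared with the full tree, whose leaves are all blocks, the true parameters lose `O(log n)`.
  have hU : ∀ w : Fin D → Fin m, ∀ᶠ n : ℕ in atTop,
      logMaxLik (blockCount D x n w) ≤ blockLogLik T θ x n w + 1 * Real.log n := by
    intro w
    have := h.eventually_logMaxLik_le hθ hirr (Finset.singleton_nonempty w)
      (q := stepProb T θ w) ⟨stepProb_nonneg hθ w, sum_stepProb hθ w⟩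
      (fun v hv j => by rw [Finset.mem_singleton.1 hv]) one_pos
    filter_upwards [this] with n hn
    have h2 : pooledCount D x n {w} = blockCount D x n w := by
      funext j; simp [pooledCount]
    simpa [h2] using hn
  -- The linear gap `c₁ * n` beats the logarithmic terms.
  set c₁ : ℝ := c / 8 * (δ / 2) ^ 2 with hc₁
  have hc₁0 : 0 < c₁ := by positivity
  have hlin : ∀ᶠ n : ℕ in atTop, (Q + K' * r) * Real.log n +
      (B + C' + K' * (r * Real.log 2) + K * C) ≤ c₁ * n := by
    have h1 : (fun n : ℕ => (Q + K' * r) * Real.log n) =o[atTop] fun n : ℕ => (n : ℝ) :=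
      (Real.isLittleO_log_id_atTop.comp_tendsto tendsto_natCast_atTop_atTop).const_mul_left _
    have h2 : ∀ᶠ n : ℕ in atTop, B + C' + K' * (r * Real.log 2) + K * C ≤ c₁ / 2 * n :=
      (tendsto_natCast_atTop_atTop.const_mul_atTop (by positivity)).eventually_ge_atTop _
    filter_upwards [h1.bound (show 0 < c₁ / 2 by positivity), h2] with n h3 h4
    have h5 := (le_abs_self _).trans h3
    rw [Real.norm_of_nonneg (Nat.cast_nonneg n)] at h5
    linarith
  filter_upwards [eventually_all.2 hU, hcn, eventually_ge_atTop 1, hlin,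
    h.eventually_abs_le z i (show 0 < c * δ / 4 by positivity),
    h.eventually_abs_le z' i (show 0 < c * δ / 4 by positivity)] with n h1 h2 hn h3 hdz hdz'
  have hn0 : (1 : ℝ) ≤ n := by exact_mod_cast hn
  have hcn0 : 0 < c * n := by positivity
  have hfreq : ∀ (w : Fin D → Fin m), |(blockCount D x n w i : ℝ) - stepProb T θ w i *
      visits D x n w| ≤ c * δ / 4 * n →
        |(blockCount D x n w i : ℝ) / visits D x n w - stepProb T θ w i| ≤ δ / 4 := by
    intro w hw
    have hv : (0 : ℝ) < visits D x n w := hcn0.trans_le (h2 w)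
    have h4 : (blockCount D x n w i : ℝ) / visits D x n w - stepProb T θ w i =
        ((blockCount D x n w i : ℝ) - stepProb T θ w i * visits D x n w) / visits D x n w := by
      field_simp
    rw [h4, abs_div, abs_of_pos hv, div_le_iff₀ hv]
    refine hw.trans ?_
    nlinarith [h2 w]
  have hgap : (δ / 2) ^ 2 ≤ ((blockCount D x n z i : ℝ) / visits D x n z -
      (blockCount D x n z' i : ℝ) / visits D x n z') ^ 2 := by
    have ha := abs_le.1 (hfreq z hdz)
    have hb := abs_le.1 (hfreq z' hdz')
    rw [← hp] at ha
    rw [← hp'] at hb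
    rw [← sq_abs (_ - _)]
    refine pow_le_pow_left₀ (by positivity) ?_ 2
    rcases abs_cases (p - p') with ⟨he, _⟩ | ⟨he, _⟩
    · rw [← hδ] at he
      exact le_trans (by linarith) (le_abs_self _)
    · rw [← hδ] at he
      exact le_trans (by linarith) (neg_le_abs _)
  have hs : ∀ s : S.leaves, logMaxLik (count D x n s.1) + (if s = ⟨s₀, hs₀⟩ then c₁ * n else 0) ≤
      ∑ w with IsContext s.1 w, logMaxLik (blockCount D x n w) := by
    intro s
    rw [count_eq_pooledCount]
    split_ifs with hs
    · subst hs
      refine le_trans ?_ (logMaxLik_sum_add_le (Finset.univ.filter fun w => IsContext s₀ w)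
        (blockCount D x n) (z := z) (z' := z') (by simpa using hsz) (by simpa using hsz') i
        (h2 z) (h2 z') hcn0)
      refine add_le_add le_rfl ?_
      calc c₁ * n = c * n / 8 * (δ / 2) ^ 2 := by rw [hc₁]; ring
        _ ≤ _ := mul_le_mul_of_nonneg_left hgap (by positivity)
    · obtain ⟨w, hw⟩ := exists_isContext hm0 (S.length_le s.2)
      have := logMaxLik_sum_add_le (Finset.univ.filter fun w => IsContext s.1 w)
        (blockCount D x n) (z := w) (z' := w) (by simpa using hw) (by simpa using hw) i
        (h2 w) (h2 w) hcn0
      rw [sub_self, zero_pow two_ne_zero, mul_zero, add_zero] at this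
      rw [add_zero]
      exact this
  have hsum := Finset.sum_le_sum fun s (_ : s ∈ Finset.univ) => hs s
  rw [Finset.sum_add_distrib, sum_leaves_sum_context] at hsum
  have hite : ∑ s : S.leaves, (if s = ⟨s₀, hs₀⟩ then c₁ * (n : ℝ) else 0) = c₁ * n := by simp
  rw [hite] at hsum
  have hkt := Finset.sum_le_sum fun (s : S.leaves) (_ : s ∈ Finset.univ) =>
    hC (count D x n s.1)
  rw [← log_marginal hm0, Finset.sum_add_distrib] at hkt
  have hfull := Finset.sum_le_sum fun w (_ : w ∈ Finset.univ) => h1 w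
  rw [Finset.sum_add_distrib] at hfull
  simp only [Finset.sum_const, Finset.card_univ, Fintype.card_coe, nsmul_eq_mul,
    one_mul] at hkt hfull
  have h10 := hC' n
  have h11 := mul_le_mul_of_nonneg_left (log_add_one_le hn)
    (show 0 ≤ K' * r from mul_nonneg (Nat.cast_nonneg _) hr0)
  linarith

theorem Typical.eventually_log_marginal_lt (h : Typical T θ x) (hθ : T.IsParam θ)
    (hmin : T.IsMinimal θ) (hirr : (transMatrix T θ).IsIrreducible) (hm : 2 ≤ m) {S : Model m D}
    (hne : S ≠ T) (B : ℝ) :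
    ∀ᶠ n : ℕ in atTop, Real.log (marginal x n S) + B ≤ Real.log (marginal x n T) := by
  by_cases hS : S.1.Refines T.1
  · exact h.eventually_log_marginal_lt_of_refines hθ hirr hm hS hne B
  · exact h.eventually_log_marginal_lt_of_not_refines hθ hmin hirr hm hS B

end Typical

/-! ### Consistency of the MAP model -/

theorem modelPrior_pos {m D : ℕ} {β : ℝ} (hβ : β ∈ Set.Ioo (0 : ℝ) 1) (T : Model m D) :
    0 < modelPrior β T :=
  mul_pos (pow_pos (Real.rpow_pos_of_pos (by linarith [hβ.2]) _) _) (pow_pos hβ.1 _)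

end BCT

theorem theorem5 {m : ℕ} (hm : 2 ≤ m) (D : ℕ) (β : ℝ) (hβ : β ∈ Set.Ioo (0 : ℝ) 1)
    {Ω : Type*} [MeasurableSpace Ω] (μ : Measure Ω) [IsProbabilityMeasure μ]
    (X : ℕ → Ω → Fin m) (Tstar : BCT.Model m D) (θstar : Tstar.Params)
    (hθ : Tstar.IsParam θstar) (hmin : Tstar.IsMinimal θstar)
    (herg : BCT.IsErgodic Tstar θstar) (hX : BCT.IsChain μ X Tstar θstar) :
    ∀ᵐ ω ∂μ, ∀ᶠ n : ℕ in atTop, ∀ T : BCT.Model m D,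
      BCT.IsMAP β (fun k => X k ω) n T ↔ T = Tstar := by
  have hm0 : 0 < m := by omega
  filter_upwards [hX.ae_typical hm0 hθ] with ω hω
  have hprior := fun T : BCT.Model m D => BCT.modelPrior_pos hβ T
  have hlt : ∀ T : BCT.Model m D, ∀ᶠ n : ℕ in atTop, T ≠ Tstar →
      BCT.modelPrior β T * BCT.marginal (fun k => X k ω) n T <
        BCT.modelPrior β Tstar * BCT.marginal (fun k => X k ω) n Tstar := by
    intro T
    by_cases hT : T = Tstar
    · exact Eventually.of_forall fun n h => absurd hT h
    filter_upwards [hω.eventually_log_marginal_lt hθ hmin herg.1 hm hT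
      (Real.log (BCT.modelPrior β T) - Real.log (BCT.modelPrior β Tstar) + 1)] with n hn _
    have h1 := BCT.marginal_pos (x := fun k => X k ω) hm0 n T
    have h2 := BCT.marginal_pos (x := fun k => X k ω) hm0 n Tstar
    refine (Real.log_lt_log_iff (mul_pos (hprior T) h1) (mul_pos (hprior Tstar) h2)).1 ?_
    rw [Real.log_mul (hprior T).ne' h1.ne', Real.log_mul (hprior Tstar).ne' h2.ne']
    linarith
  filter_upwards [eventually_all.2 hlt] with n hn T
  have hden : 0 < ∑ T' : BCT.Model m D, BCT.modelPrior β T' *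
      BCT.marginal (fun k => X k ω) n T' :=
    Finset.sum_pos (fun T' _ => mul_pos (hprior T') (BCT.marginal_pos hm0 n T'))
      ⟨Tstar, Finset.mem_univ _⟩
  constructor
  · intro hT
    by_contra hne
    exact absurd (hT Tstar) (not_le.2 (div_lt_div_of_pos_right (hn T hne) hden))
  · rintro rfl T'
    by_cases hne : T' = T
    · rw [hne]
    · exact (div_lt_div_of_pos_right (hn T' hne) hden).le
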